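/- Let $k$ be a field, $q\in k^\times$, and let $d_1,d_2,e\ge 0$ be integers. **Setting.** Let $\mathcal V$ be the category of finite dimensional $k$-vector spaces, each with a chosen basis. For spaces $W,V$ with bases $(w_j),(v_i)$ and endomorphisms $R_W,R_V$ of $W\otimes W,V\otimes V$, with coefficients $R_V(v_i\otimes v_j)=\sum_{a,b}R^{ab}_{V,ij}\,v_a\otimes v_b$, let $A(W,V)$ be the algebra with generators $x_{ji}$ ($j$ an index for $W$, $i$ an index for $V$) and relations $\sum_{a,b}R^{pr}_{W,ab}x_{ai}x_{bj}=\sum_{a,b}R^{ab}_{V,ij}x_{pa}x_{rb}$, graded with $A(W,V)_d$ spanned by products of $d$ generators. Let $\Delta_{U,W,V}:A(U,V)\to A(U,W)\otimes A(W,V)$, $x_{ij}\mapsto\sum_l x_{il}\otimes x_{lj}$, and $\varepsilon_V:A(V,V)\to k$, $x_{ij}\mapsto\delta_{ij}$; these make $A(V,V)$ a bialgebra. Let $A_q(n,n)=A(V_n,V_n)$ for $V_n=k^n$ with the standard $R$-matrix $R_n$: $R_n(v_i\otimes v_j)=v_j\otimes v_i$ if $i<j$, $q\,v_i\otimes v_i$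 if $i=j$, and $(q-q^{-1})v_i\otimes v_j+v_j\otimes v_i$ if $i>j$. Let $\mathcal R$ be the universal $R$-form on $A_q(n,n)$, i.e. the bilinear form with $\mathcal R(x_{ij},x_{kl})=(R_n)^{ik}_{lj}$, $\mathcal R(1,c)=\mathcal R(c,1)=\varepsilon(c)$, $\mathcal R(a,bc)=\mathcal R(a_{(1)},b)\mathcal R(a_{(2)},c)$ and $\mathcal R(ab,c)=\mathcal R(a,c_{(2)})\mathcal R(b,c_{(1)})$. An *$e$-Hecke pair* is a finite dimensional $A_q(n,n)$-comodule $V$, for some $n\ge1$, with coaction $\Delta_V(v_i)=\sum_j v_j\otimes t^V_{ji}$ taking values in $V\otimes A_q(n,n)_e$. Its $R$-matrix is $R_V=(1\otimes1\otimes\mathcal R)(1\otimes\tau\otimes1)(\Delta_V\otimes\Delta_V)\tau$, where $\tau$ denotes the flip, and we write $A_q(W,V)=A(W,V)$ for these $R$-matrices. The category $\Gamma^d_{q,e}\mathcal V$ has the $e$-Hecke pairs as objects, and its morphisms $V\to W$ are the linear maps $V^{\otimes d}\to W^{\otimes d}$ that commute with $1^{\otimes (i-1)}\otimes R\otimes 1^{\otimes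 (d-i-1)}$ for $1\le i\le d-1$ ($R=R_V$, respectively $R_W$). A *quantum polynomial functor* in $\mathcal P^d_{q,e}$ is a $k$-linear functor $F:\Gamma^d_{q,e}\mathcal V\to\mathcal V$. Through the natural map $(A_q(W,V)_d)^*\to \mathrm{Hom}_{\Gamma^d_{q,e}}(V,W)$, which sends $\varphi$ to the linear map with matrix coefficients $\varphi(x_{j_1i_1}\cdots x_{j_di_d})$, the action of $F$ on morphisms gives a *structure map* $F''_{V,W}:F(V)\to F(W)\otimes A_q(W,V)_d$, namely $F''_{V,W}(v)=\sum_\beta F(a_\beta^*)(v)\otimes a_\beta$ for a basis $(a_\beta)$ of $A_q(W,V)_d$ with dual basis $(a_\beta^*)$. **Theorem.** Let $G\in\mathcal P^{d_2}_{q,e}$ and $F\in\mathcal P^{d_1}_{q,d_2e}$. 1. For every $e$-Hecke pair $V$, $x_{ji}\mapsto t^V_{ji}$ defines an algebra homomorphism $\psi_V:A_q(V,V)\to A_q(n,n)$, and $G(V)$ with $(1\otimes\psi_V)G''_{V,V}$ is a $d_2e$-Hecke pair. 2. For all $e$-Hecke pairs $V,W$, writing $G''_{V,W}(v^G_i)=\sum_j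 w^G_j\otimes t^{W,V}_{ji}$ on the chosen bases $(v^G_i)$ of $G(V)$ and $(w^G_j)$ of $G(W)$, $x_{ji}\mapsto t^{W,V}_{ji}$ defines an algebra homomorphism $\psi^G_{W,V}:A_q(G(W),G(V))\to A_q(W,V)$. 3. Put $(F\circ G)(V)=F(G(V))$ and $(F\circ G)''_{V,W}=(1\otimes\psi^G_{W,V})\circ F''_{G(V),G(W)}$. Then $(F\circ G)''_{V,W}$ takes values in $F(G(W))\otimes A_q(W,V)_{d_1d_2}$, and for all $e$-Hecke pairs $V,W,U$ $$\big((F\circ G)''_{W,U}\otimes 1\big)(F\circ G)''_{V,W}=(1\otimes\Delta_{U,W,V})(F\circ G)''_{V,U},\qquad (1\otimes\varepsilon_V)(F\circ G)''_{V,V}=1 .$$ 4. There is exactly one quantum polynomial functor in $\mathcal P^{d_1d_2}_{q,e}$ with values $F(G(V))$ on objects and structure maps $(F\circ G)''_{V,W}$. Thus $F\circ G$ is a well-defined quantum polynomial functor in $\mathcal P^{d_1d_2}_{q,e}$. -/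

import Mathlib

open CategoryTheory TensorProduct

universe u v

namespace QPoly

noncomputable section

/-- Coefficients `R p q i j = R^{pq}_{ij}` of an endomorphism of `V ⊗ V` in a chosen basis:
`R (v_i ⊗ v_j) = ∑_{p,q} R^{pq}_{ij} v_p ⊗ v_q`. -/
abbrev RCoeff (k : Type u) (ι : Type) : Type u := ι → ι → ι → ι → k

theorem sum_comm_four {α β γ δ M : Type*} [Fintype α] [Fintype β] [Fintype γ] [Fintype δ]
    [AddCommMonoid M] (f : α → β → γ → δ → M) :
    ∑ a, ∑ b, ∑ l, ∑ m, f a b l m = ∑ l, ∑ m, ∑ a, ∑ b, f a b l m := by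
  calc _ = ∑ x : α × β, ∑ y : γ × δ, f x.1 x.2 y.1 y.2 := by simp only [Fintype.sum_prod_type]
    _ = ∑ y : γ × δ, ∑ x : α × β, f x.1 x.2 y.1 y.2 := Finset.sum_comm
    _ = _ := by simp only [Fintype.sum_prod_type]

section Algebra

variable {k : Type u} [Field k] {ι κ μ ν : Type}
  [Fintype ι] [Fintype κ] [Fintype μ] [Fintype ν]

/-- The quadratic relations of `A(W,V)`:
`∑_{a,b} R^{pq}_{W,ab} x_{ai} x_{bj} = ∑_{a,b} R^{ab}_{V,ij} x_{pa} x_{qb}`. -/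
inductive RTTRel (RW : RCoeff k ι) (RV : RCoeff k κ) :
    FreeAlgebra k (ι × κ) → FreeAlgebra k (ι × κ) → Prop
  | mk (p q : ι) (i j : κ) : RTTRel RW RV
      (∑ a, ∑ b, RW p q a b • (FreeAlgebra.ι k (a, i) * FreeAlgebra.ι k (b, j)))
      (∑ a, ∑ b, RV a b i j • (FreeAlgebra.ι k (p, a) * FreeAlgebra.ι k (q, b)))

/-- The quantum Hom-space algebra `A(W,V)` of two Yang-Baxter spaces, given by the coefficients
of their `R`-matrices in chosen bases: generators `x_{ji}` (`j` an index of the basis of `W`, `i`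
an index of the basis of `V`) and the quadratic relations above. -/
def HomAlg (RW : RCoeff k ι) (RV : RCoeff k κ) : Type u := RingQuot (RTTRel RW RV)

namespace HomAlg

instance (RW : RCoeff k ι) (RV : RCoeff k κ) : Ring (HomAlg RW RV) :=
  inferInstanceAs (Ring (RingQuot (RTTRel RW RV)))

instance (RW : RCoeff k ι) (RV : RCoeff k κ) : Algebra k (HomAlg RW RV) :=
  inferInstanceAs (Algebra k (RingQuot (RTTRel RW RV)))

/-- The generator `x_{ji}` of `A(W,V)`. -/
def gen (RW : RCoeff k ι) (RV : RCoeff k κ) (j : ι) (i : κ) : HomAlg RW RV :=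
  RingQuot.mkAlgHom k (RTTRel RW RV) (FreeAlgebra.ι k (j, i))

end HomAlg

/-- A matrix `t` with entries in an algebra `B` satisfies the quadratic relations of `A(W,V)`. -/
def SatisfiesRTT (RW : RCoeff k ι) (RV : RCoeff k κ) {B : Type*} [Ring B] [Algebra k B]
    (t : ι → κ → B) : Prop :=
  ∀ p q i j, ∑ a, ∑ b, RW p q a b • (t a i * t b j) = ∑ a, ∑ b, RV a b i j • (t p a * t q b)

namespace HomAlg

theorem satisfiesRTT_gen (RW : RCoeff k ι) (RV : RCoeff k κ) :
    SatisfiesRTT RW RV (gen RW RV) := by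
  intro p q i j
  have h := RingQuot.mkAlgHom_rel k (RTTRel.mk (RW := RW) (RV := RV) p q i j)
  simp only [map_sum, map_smul, map_mul] at h
  exact h

/-- The algebra homomorphism `A(W,V) → B` that sends `x_{ji}` to `t_{ji}`. -/
def lift (RW : RCoeff k ι) (RV : RCoeff k κ) {B : Type*} [Ring B] [Algebra k B]
    (t : ι → κ → B) (ht : SatisfiesRTT RW RV t) : HomAlg RW RV →ₐ[k] B :=
  RingQuot.liftAlgHom k ⟨FreeAlgebra.lift k (fun x : ι × κ => t x.1 x.2), by
    rintro _ _ ⟨p, q, i, j⟩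
    simpa only [map_sum, map_smul, map_mul, FreeAlgebra.lift_ι_apply] using ht p q i j⟩

@[simp] theorem lift_gen (RW : RCoeff k ι) (RV : RCoeff k κ) {B : Type*} [Ring B] [Algebra k B]
    (t : ι → κ → B) (ht : SatisfiesRTT RW RV t) (j : ι) (i : κ) :
    lift RW RV t ht (gen RW RV j i) = t j i := by
  unfold lift gen
  erw [RingQuot.liftAlgHom_mkAlgHom_apply]
  simp

theorem algHom_ext {RW : RCoeff k ι} {RV : RCoeff k κ} {B : Type*} [Ring B] [Algebra k B]
    {f g : HomAlg RW RV →ₐ[k] B} (h : ∀ j i, f (gen RW RV j i) = g (gen RW RV j i)) : f = g := by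
  apply RingQuot.ringQuot_ext' (S := k)
  apply FreeAlgebra.hom_ext
  funext x
  exact h x.1 x.2

/-- The comultiplication `Δ_{V,W,U} : A(V,U) → A(V,W) ⊗ A(W,U)`,
`x_{ij} ↦ ∑_l x_{il} ⊗ x_{lj}`. -/
def comul (RV : RCoeff k ι) (RW : RCoeff k κ) (RU : RCoeff k μ) :
    HomAlg RV RU →ₐ[k] HomAlg RV RW ⊗[k] HomAlg RW RU :=
  lift RV RU (fun i j => ∑ l, gen RV RW i l ⊗ₜ[k] gen RW RU l j) (by
    intro p q i j
    have e1 : ∀ a b (i j : μ), (∑ l, gen RV RW a l ⊗ₜ[k] gen RW RU l i) *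
        (∑ m, gen RV RW b m ⊗ₜ[k] gen RW RU m j) =
        ∑ l, ∑ m, (gen RV RW a l * gen RV RW b m) ⊗ₜ[k] (gen RW RU l i * gen RW RU m j) := by
      intro a b i j
      rw [Finset.sum_mul_sum]
      simp only [Algebra.TensorProduct.tmul_mul_tmul]
    calc _ = ∑ l, ∑ m, (∑ a, ∑ b, RV p q a b • (gen RV RW a l * gen RV RW b m)) ⊗ₜ[k]
          (gen RW RU l i * gen RW RU m j) := by
          simp only [e1, Finset.smul_sum, TensorProduct.sum_tmul, TensorProduct.smul_tmul']
          exact sum_comm_four _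
      _ = ∑ a, ∑ b, (gen RV RW p a * gen RV RW q b) ⊗ₜ[k]
          (∑ l, ∑ m, RW a b l m • (gen RW RU l i * gen RW RU m j)) := by
          simp only [satisfiesRTT_gen RV RW p q, TensorProduct.tmul_sum, TensorProduct.sum_tmul,
            ← TensorProduct.smul_tmul', TensorProduct.tmul_smul]
          exact sum_comm_four _
      _ = _ := by
          simp only [satisfiesRTT_gen RW RU _ _ i j, e1, Finset.smul_sum, TensorProduct.tmul_sum,
            TensorProduct.tmul_smul]
          exact sum_comm_four _)

@[simp] theorem comul_gen (RV : RCoeff k ι) (RW : RCoeff k κ) (RU : RCoeff k μ) (i : ι) (j : μ) :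
    comul RV RW RU (gen RV RU i j) = ∑ l, gen RV RW i l ⊗ₜ[k] gen RW RU l j := by
  exact lift_gen _ _ _ _ _ _

/-- The counit `e : A(V,V) → k`, `x_{ij} ↦ δ_{ij}`. -/
def counit [DecidableEq ι] (R : RCoeff k ι) : HomAlg R R →ₐ[k] k :=
  lift R R (fun i j => if i = j then 1 else 0) (by
    intro p q i j
    simp)

@[simp] theorem counit_gen [DecidableEq ι] (R : RCoeff k ι) (i j : ι) :
    counit R (gen R R i j) = if i = j then 1 else 0 := by
  exact lift_gen _ _ _ _ _ _

/-- `A(V,V)` is a bialgebra. -/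
instance [DecidableEq ι] (R : RCoeff k ι) : Bialgebra k (HomAlg R R) :=
  Bialgebra.ofAlgHom (comul R R R) (counit R)
    (by
      apply algHom_ext
      intro j i
      simp [TensorProduct.sum_tmul, TensorProduct.tmul_sum]
      exact Finset.sum_comm)
    (by
      apply algHom_ext
      intro j i
      simp [ite_tmul])
    (by
      apply algHom_ext
      intro j i
      simp [tmul_ite])

/-- The degree `d` part `A(W,V)_d`: the span of the products of `d` generators. -/
def deg (RW : RCoeff k ι) (RV : RCoeff k κ) (d : ℕ) : Submodule k (HomAlg RW RV) :=
  Submodule.span k (Set.range fun x : ι × κ => gen RW RV x.1 x.2) ^ d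

instance (RW : RCoeff k ι) (RV : RCoeff k κ) (d : ℕ) : Module.Finite k (deg RW RV d) :=
  Module.Finite.iff_fg.2 (Submodule.FG.pow (Submodule.fg_span (Set.finite_range _)) d)

/-- The monomial `x_{j_1 i_1} ⋯ x_{j_d i_d}`. -/
def monomial (RW : RCoeff k ι) (RV : RCoeff k κ) {d : ℕ} (j : Fin d → ι) (i : Fin d → κ) :
    HomAlg RW RV :=
  (List.ofFn fun s => gen RW RV (j s) (i s)).prod

theorem monomial_mem (RW : RCoeff k ι) (RV : RCoeff k κ) {d : ℕ} (j : Fin d → ι)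
    (i : Fin d → κ) : monomial RW RV j i ∈ deg RW RV d := by
  unfold monomial deg
  induction d with
  | zero => simp [Submodule.one_le.1 le_rfl]
  | succ d ih =>
    rw [List.ofFn_succ, List.prod_cons, pow_succ']
    exact Submodule.mul_mem_mul (Submodule.subset_span ⟨(j 0, i 0), rfl⟩)
      (ih (fun s => j s.succ) (fun s => i s.succ))

theorem exists_prod_update {M : Type*} [Monoid M] {d : ℕ} (f : Fin d → M) (s : ℕ)
    (hs : s + 1 < d) : ∃ P S : M, ∀ a b : M,
      (List.ofFn (Function.update (Function.update f ⟨s, by omega⟩ a) ⟨s + 1, hs⟩ b)).prod =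
        P * (a * b) * S := by
  have key : ∀ (L : List M) (s : ℕ), s + 1 < L.length → ∃ P S : M, ∀ a b : M,
      ((L.set s a).set (s + 1) b).prod = P * (a * b) * S := by
    intro L
    induction L with
    | nil => intro s h; simp at h
    | cons x L ih =>
      intro s h
      cases s with
      | zero =>
        cases L with
        | nil => simp at h
        | cons y L => exact ⟨1, L.prod, fun a b => by simp [mul_assoc]⟩
      | succ s =>
        obtain ⟨P, S, hPS⟩ := ih s (by simpa using h)
        exact ⟨x * P, S, fun a b => by simp [hPS, mul_assoc]⟩
  obtain ⟨P, S, h⟩ := key (List.ofFn f) s (by simpa using hs)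
  refine ⟨P, S, fun a b => ?_⟩
  rw [← h]
  congr 1
  apply List.ext_getElem
  · simp
  · intro n h1 h2
    simp only [List.getElem_ofFn, List.getElem_set, Function.update_apply, Fin.ext_iff]
    grind

/-- Replace the entries number `s` and `s + 1` of a multi-index. -/
def subst {α : Type*} {d : ℕ} (c : Fin d → α) (s : ℕ) (hs : s + 1 < d) (a b : α) : Fin d → α :=
  Function.update (Function.update c ⟨s, by omega⟩ a) ⟨s + 1, hs⟩ b

theorem monomial_relation (RW : RCoeff k ι) (RV : RCoeff k κ) {d : ℕ} (j : Fin d → ι)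
    (i : Fin d → κ) (s : ℕ) (hs : s + 1 < d) :
    ∑ a, ∑ b, RV a b (i ⟨s, by omega⟩) (i ⟨s + 1, hs⟩) • monomial RW RV j (subst i s hs a b) =
      ∑ a, ∑ b, RW (j ⟨s, by omega⟩) (j ⟨s + 1, hs⟩) a b •
        monomial RW RV (subst j s hs a b) i := by
  obtain ⟨P, S, h⟩ := exists_prod_update (fun s => gen RW RV (j s) (i s)) s hs
  have h1 : ∀ a b, monomial RW RV j (subst i s hs a b) =
      P * (gen RW RV (j ⟨s, by omega⟩) a * gen RW RV (j ⟨s + 1, hs⟩) b) * S := by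
    intro a b
    rw [← h]
    unfold monomial subst
    congr 2
    funext t
    simp only [Function.update_apply]
    grind
  have h2 : ∀ a b, monomial RW RV (subst j s hs a b) i =
      P * (gen RW RV a (i ⟨s, by omega⟩) * gen RW RV b (i ⟨s + 1, hs⟩)) * S := by
    intro a b
    rw [← h]
    unfold monomial subst
    congr 2
    funext t
    simp only [Function.update_apply]
    grind
  have h3 := congrArg (fun y => P * y * S) (satisfiesRTT_gen RW RV (j ⟨s, by omega⟩)
    (j ⟨s + 1, hs⟩) (i ⟨s, by omega⟩) (i ⟨s + 1, hs⟩))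
  simp only [Finset.mul_sum, Finset.sum_mul, mul_smul_comm, smul_mul_assoc] at h3
  simp only [h1, h2]
  exact h3.symm

theorem subst_left {α : Type*} {d : ℕ} (c : Fin d → α) (s : ℕ) (hs : s + 1 < d) (a b : α) :
    subst c s hs a b ⟨s, by omega⟩ = a := by
  simp [subst]

theorem subst_right {α : Type*} {d : ℕ} (c : Fin d → α) (s : ℕ) (hs : s + 1 < d) (a b : α) :
    subst c s hs a b ⟨s + 1, hs⟩ = b := by
  simp [subst]

theorem subst_subst {α : Type*} {d : ℕ} (c : Fin d → α) (s : ℕ) (hs : s + 1 < d) (a b : α) :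
    subst (subst c s hs a b) s hs (c ⟨s, by omega⟩) (c ⟨s + 1, hs⟩) = c := by
  funext t
  simp only [subst, Function.update_apply]
  grind

/-- Reindexing of a sum over multi-indices and their substitutions. -/
theorem sum_subst {M : Type*} [AddCommMonoid M] {d : ℕ} (s : ℕ) (hs : s + 1 < d)
    (g : (Fin d → ι) → (Fin d → ι) → M) :
    ∑ j : Fin d → ι, ∑ a, ∑ b, g j (subst j s hs a b) =
      ∑ j : Fin d → ι, ∑ a, ∑ b, g (subst j s hs a b) j := by
  have e : ∀ f : (Fin d → ι) → ι → ι → M, ∑ j, ∑ a, ∑ b, f j a b =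
      ∑ x : (Fin d → ι) × ι × ι, f x.1 x.2.1 x.2.2 := by
    intro f
    simp only [Fintype.sum_prod_type]
  rw [e, e]
  refine Finset.sum_nbij'
    (fun x => (subst x.1 s hs x.2.1 x.2.2, x.1 ⟨s, by omega⟩, x.1 ⟨s + 1, hs⟩))
    (fun x => (subst x.1 s hs x.2.1 x.2.2, x.1 ⟨s, by omega⟩, x.1 ⟨s + 1, hs⟩))
    (fun _ _ => Finset.mem_univ _) (fun _ _ => Finset.mem_univ _) ?_ ?_ ?_
  · rintro ⟨j, a, b⟩ _
    simp only [subst_left, subst_right, subst_subst]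
  · rintro ⟨j, a, b⟩ _
    simp only [subst_left, subst_right, subst_subst]
  · rintro ⟨j, a, b⟩ _
    simp only [subst_subst]

end HomAlg
end Algebra

section UniversalR

variable {k : Type u} [Field k]

/-- Coefficients of the standard `R`-matrix `R_n` of `U_q(gl_n)`: `v_i ⊗ v_j` is sent to
`v_j ⊗ v_i` if `i < j`, to `q v_i ⊗ v_i` if `i = j`, and to
`(q - q⁻¹) v_i ⊗ v_j + v_j ⊗ v_i` if `i > j`. -/
def stdR (q : kˣ) (n : ℕ) : RCoeff k (Fin n) := fun a b i j =>
  if i < j then (if a = j ∧ b = i then 1 else 0)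
  else if i = j then (if a = i ∧ b = j then (q : k) else 0)
  else (if a = i ∧ b = j then (q : k) - (q : k)⁻¹ else 0) + (if a = j ∧ b = i then 1 else 0)

theorem stdR_sum (q : kˣ) (n : ℕ) (i j : Fin n) (g : Fin n → Fin n → k) :
    ∑ a, ∑ b, stdR q n a b i j * g a b =
      (if i < j then 0 else if i = j then (q : k) else (q : k) - (q : k)⁻¹) * g i j +
      (if i = j then 0 else 1) * g j i := by
  rcases lt_trichotomy i j with h | h | h
  · simp [stdR, h, h.ne, ite_and]
  · subst h
    simp [stdR, ite_and]
  · simp [stdR, h.not_gt, h.ne', ite_and, add_mul, Finset.sum_add_distrib]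

theorem stdR_ybe_fun (q : kˣ) (n : ℕ) (b i j : Fin n) (h : Fin n → Fin n → Fin n → k) :
    ∑ x, ∑ c, stdR q n x c b i * ∑ l, ∑ m, stdR q n l m c j *
        ∑ u, ∑ w, stdR q n u w x l * h u w m =
      ∑ x, ∑ l, stdR q n x l i j * ∑ u, ∑ c, stdR q n u c b x *
        ∑ w, ∑ m, stdR q n w m c l * h u w m := by
  have hq : (q : k) ≠ 0 := q.ne_zero
  simp only [stdR_sum]
  rcases lt_trichotomy b i with h1 | h1 | h1 <;> rcases lt_trichotomy i j with h2 | h2 | h2 <;>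
    rcases lt_trichotomy b j with h3 | h3 | h3 <;>
    first
    | (exfalso; omega)
    | (try subst h1
       try subst h2
       try subst h3
       simp [*, not_lt_of_gt, ne_of_gt, ne_of_lt]
       try field_simp
       try ring)

theorem stdR_ybe (q : kˣ) (n : ℕ) (p r a b i j : Fin n) :
    ∑ x, ∑ l, stdR q n p r x l * ∑ c, stdR q n l a c j * stdR q n x c b i =
      ∑ x, ∑ l, stdR q n x l i j * ∑ c, stdR q n r a c l * stdR q n p c b x := by
  have := stdR_ybe_fun q n b i j fun u w m => if u = p then if w = r then if m = a then 1 else 0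
    else 0 else 0
  simp only [mul_ite, mul_one, mul_zero, Finset.sum_ite_eq', Finset.mem_univ, if_true,
    Finset.sum_ite_irrel, Finset.sum_const_zero] at this
  calc _ = ∑ x, ∑ c, stdR q n x c b i * ∑ l, stdR q n l a c j * stdR q n p r x l := by
        refine Finset.sum_congr rfl fun x _ => ?_
        simp only [Finset.mul_sum]
        rw [Finset.sum_comm]
        exact Finset.sum_congr rfl fun _ _ => Finset.sum_congr rfl fun _ _ => by ring
    _ = _ := this
    _ = _ := by simp only [mul_comm]

/-- The right comodule structure of the defining representation, as an algebra homomorphism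
from `A_q(n,n)` to the opposite of a matrix algebra: the entry `(a, b)` of the image of `y` is
the value `𝓡(y, x_{ab})` of the universal `R`-matrix. -/
def matrixR (q : kˣ) (n : ℕ) :
    HomAlg (stdR q n) (stdR q n) →ₐ[k] (Matrix (Fin n) (Fin n) k)ᵐᵒᵖ :=
  HomAlg.lift _ _ (fun i j => MulOpposite.op (Matrix.of fun a b => stdR q n i a b j)) (by
    intro p r i j
    apply MulOpposite.unop_injective
    ext a b
    simpa [Matrix.sum_apply, Matrix.mul_apply] using stdR_ybe q n p r a b i j)

@[simp] theorem matrixR_gen (q : kˣ) (n : ℕ) (i j : Fin n) :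
    matrixR q n (HomAlg.gen _ _ i j) =
      MulOpposite.op (Matrix.of fun a b => stdR q n i a b j) :=
  HomAlg.lift_gen _ _ _ _ _ _

/-- The functional `y ↦ 𝓡(y, x_{ab})` on `A_q(n,n)`, an element of the convolution algebra. -/
def functionalR (q : kˣ) (n : ℕ) (a b : Fin n) :
    WithConv (HomAlg (stdR q n) (stdR q n) →ₗ[k] k) :=
  WithConv.toConv
    { toFun := fun y => (matrixR q n y).unop a b
      map_add' := fun y z => by simp
      map_smul' := fun c y => by simp }

theorem functionalR_apply (q : kˣ) (n : ℕ) (a b : Fin n) (y : HomAlg (stdR q n) (stdR q n)) :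
    functionalR q n a b y = (matrixR q n y).unop a b := rfl

theorem functionalR_mul_one (q : kˣ) (n : ℕ) (a b c d : Fin n) :
    (functionalR q n a b * functionalR q n c d) (1 : HomAlg (stdR q n) (stdR q n)) =
      (if a = b then 1 else 0) * (if c = d then 1 else 0) := by
  rw [LinearMap.convMul_apply, Bialgebra.comul_one, Algebra.TensorProduct.one_def,
    TensorProduct.map_tmul, LinearMap.mul'_apply]
  change functionalR q n a b 1 * functionalR q n c d 1 = _
  simp [functionalR_apply, Matrix.one_apply]

theorem functionalR_mul_gen (q : kˣ) (n : ℕ) (a b c d i j : Fin n) :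
    (functionalR q n a b * functionalR q n c d) (HomAlg.gen (stdR q n) (stdR q n) i j) =
      ∑ l, stdR q n i a b l * stdR q n l c d j := by
  rw [LinearMap.convMul_apply]
  change LinearMap.mul' k k (TensorProduct.map _ _ (HomAlg.comul _ _ _ _)) = _
  rw [HomAlg.comul_gen, map_sum, map_sum]
  refine Finset.sum_congr rfl fun l _ => ?_
  rw [TensorProduct.map_tmul, LinearMap.mul'_apply]
  change functionalR q n a b _ * functionalR q n c d _ = _
  simp [functionalR_apply]

theorem functionalR_mul_mul (q : kˣ) (n : ℕ) (a b c d : Fin n)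
    (y z : HomAlg (stdR q n) (stdR q n)) :
    (functionalR q n a b * functionalR q n c d) (y * z) =
      ∑ l, ∑ m, (functionalR q n a l * functionalR q n c m) z *
        (functionalR q n l b * functionalR q n m d) y := by
  simp only [LinearMap.convMul_apply, Bialgebra.comul_mul]
  generalize Coalgebra.comul (R := k) y = s
  generalize Coalgebra.comul (R := k) z = t
  induction s with
  | zero => simp
  | add s s' hs hs' => simp only [add_mul, map_add, mul_add, hs, hs', Finset.sum_add_distrib]
  | tmul y y' =>
    induction t with
    | zero => simp
    | add t t' ht ht' => simp only [add_mul, map_add, mul_add, ht, ht', Finset.sum_add_distrib]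
    | tmul z z' =>
      simp only [Algebra.TensorProduct.tmul_mul_tmul, TensorProduct.map_tmul,
        LinearMap.mul'_apply]
      change functionalR q n a b (y * z) * functionalR q n c d (y' * z') =
        ∑ l, ∑ m, (functionalR q n a l z * functionalR q n c m z') *
          (functionalR q n l b y * functionalR q n m d y')
      simp only [functionalR_apply, map_mul, MulOpposite.unop_mul, Matrix.mul_apply,
        Finset.sum_mul_sum]
      exact Finset.sum_congr rfl fun _ _ => Finset.sum_congr rfl fun _ _ => by ring

theorem gen_induction {ι κ : Type} [Fintype ι] [Fintype κ] (RW : RCoeff k ι) (RV : RCoeff k κ)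
    {P : HomAlg RW RV → Prop}
    (one : P 1) (gen : ∀ j i, P (HomAlg.gen RW RV j i)) (mul : ∀ y z, P y → P z → P (y * z))
    (add : ∀ y z, P y → P z → P (y + z)) (smul : ∀ (c : k) y, P y → P (c • y))
    (y : HomAlg RW RV) : P y := by
  obtain ⟨y, rfl⟩ := RingQuot.mkAlgHom_surjective k (RTTRel RW RV) y
  induction y with
  | grade0 r =>
    rw [AlgHom.commutes, Algebra.algebraMap_eq_smul_one]
    exact smul _ _ one
  | grade1 x => exact gen x.1 x.2
  | mul a b ha hb => rw [map_mul]; exact mul _ _ ha hb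
  | add a b ha hb => rw [map_add]; exact add _ _ ha hb

theorem satisfiesRTT_functionalR (q : kˣ) (n : ℕ) :
    SatisfiesRTT (stdR q n) (stdR q n) (functionalR q n) := by
  suffices h : ∀ y : HomAlg (stdR q n) (stdR q n), ∀ p r i j,
      ∑ a, ∑ b, stdR q n p r a b * (functionalR q n a i * functionalR q n b j) y =
        ∑ a, ∑ b, stdR q n a b i j * (functionalR q n p a * functionalR q n r b) y by
    intro p r i j
    apply WithConv.ofConv_injective
    ext y
    simpa only [WithConv.ofConv_sum, WithConv.ofConv_smul, LinearMap.sum_apply,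
      LinearMap.smul_apply, smul_eq_mul] using h y p r i j
  intro y
  induction y using gen_induction with
  | one =>
    intro p r i j
    simp only [functionalR_mul_one]
    simp
  | gen s t =>
    intro p r i j
    simp only [functionalR_mul_gen]
    have h := stdR_ybe q n s p r i j t
    calc _ = ∑ x, ∑ l, stdR q n x l j t * ∑ c, stdR q n p r c l * stdR q n s c i x := by
          simp only [Finset.mul_sum]
          have e : ∀ f : Fin n → Fin n → Fin n → k,
              ∑ a, ∑ b, ∑ l, f a b l = ∑ l, ∑ b, ∑ a, f a b l := by
            intro f
            rw [Finset.sum_comm]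
            simp_rw [Finset.sum_comm (f := fun a l => f a _ l)]
            rw [Finset.sum_comm]
          rw [e]
          exact Finset.sum_congr rfl fun _ _ => Finset.sum_congr rfl fun _ _ =>
            Finset.sum_congr rfl fun _ _ => by ring
      _ = ∑ x, ∑ l, stdR q n s p x l * ∑ c, stdR q n l r c t * stdR q n x c i j := h.symm
      _ = _ := by
          simp only [Finset.mul_sum]
          refine Finset.sum_congr rfl fun x _ => ?_
          rw [Finset.sum_comm]
          exact Finset.sum_congr rfl fun _ _ => Finset.sum_congr rfl fun _ _ => by ring
  | mul y z hy hz =>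
    intro p r i j
    simp only [functionalR_mul_mul]
    generalize hZ : (fun a b c d => (functionalR q n a c * functionalR q n b d) z) = Z
    generalize hY : (fun a b c d => (functionalR q n a c * functionalR q n b d) y) = Y
    have hz' : ∀ p r i j, ∑ a, ∑ b, stdR q n p r a b * Z a b i j =
        ∑ a, ∑ b, stdR q n a b i j * Z p r a b := by subst hZ; exact hz
    have hy' : ∀ p r i j, ∑ a, ∑ b, stdR q n p r a b * Y a b i j =
        ∑ a, ∑ b, stdR q n a b i j * Y p r a b := by subst hY; exact hy
    suffices h : ∑ a, ∑ b, stdR q n p r a b * ∑ l, ∑ m, Z a b l m * Y l m i j =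
        ∑ a, ∑ b, stdR q n a b i j * ∑ l, ∑ m, Z p r l m * Y l m a b by
      subst hZ hY; exact h
    calc _ = ∑ l, ∑ m, (∑ a, ∑ b, stdR q n p r a b * Z a b l m) * Y l m i j := by
          simp only [Finset.mul_sum, Finset.sum_mul, ← mul_assoc]
          exact sum_comm_four _
      _ = ∑ a, ∑ b, Z p r a b * ∑ l, ∑ m, stdR q n a b l m * Y l m i j := by
          simp only [hz', Finset.mul_sum, Finset.sum_mul]
          rw [sum_comm_four]
          exact Finset.sum_congr rfl fun _ _ => Finset.sum_congr rfl fun _ _ =>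
            Finset.sum_congr rfl fun _ _ => Finset.sum_congr rfl fun _ _ => by ring
      _ = _ := by
          simp only [hy', Finset.mul_sum]
          rw [sum_comm_four]
          exact Finset.sum_congr rfl fun _ _ => Finset.sum_congr rfl fun _ _ =>
            Finset.sum_congr rfl fun _ _ => Finset.sum_congr rfl fun _ _ => by ring
  | add y z hy hz => 
    intro p r i j
    simp only [map_add, mul_add, Finset.sum_add_distrib, hy, hz]
  | smul c y hy =>
    intro p r i j
    simp only [map_smul, smul_eq_mul, mul_left_comm _ c, ← Finset.mul_sum, hy]

/-- The universal `R`-matrix of `A_q(n,n)`: the bilinear form `(y, z) ↦ 𝓡(y, z)` (here with the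
second argument first) determined by `𝓡(x_{ij}, x_{kl}) = (R_n)^{ik}_{lj}`,
`𝓡(y, z z') = 𝓡(y₁, z) 𝓡(y₂, z')` and `𝓡(y y', z) = 𝓡(y', z₁) 𝓡(y, z₂)`. -/
def universalRAux (q : kˣ) (n : ℕ) :
    HomAlg (stdR q n) (stdR q n) →ₐ[k] WithConv (HomAlg (stdR q n) (stdR q n) →ₗ[k] k) :=
  HomAlg.lift _ _ (functionalR q n) (satisfiesRTT_functionalR q n)

/-- The algebra `A_q(n,n) = A(V_n, V_n)` of quantum `n × n` matrices. -/
abbrev QMatrix (q : kˣ) (n : ℕ) : Type u := HomAlg (stdR q n) (stdR q n)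

/-- The universal `R`-matrix `𝓡(y, z)` of `A_q(n,n)`. -/
def universalR (q : kˣ) (n : ℕ) : QMatrix q n →ₗ[k] QMatrix q n →ₗ[k] k :=
  ((WithConv.linearEquiv k (QMatrix q n →ₗ[k] k)).toLinearMap ∘ₗ
    (universalRAux q n).toLinearMap).flip

theorem universalR_gen_gen (q : kˣ) (n : ℕ) (i j a b : Fin n) :
    universalR q n (HomAlg.gen _ _ i j) (HomAlg.gen _ _ a b) = stdR q n i a b j := by
  change (universalRAux q n (HomAlg.gen _ _ a b)) (HomAlg.gen _ _ i j) = _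
  rw [show universalRAux q n (HomAlg.gen _ _ a b) = functionalR q n a b from
    HomAlg.lift_gen _ _ _ _ _ _]
  simp [functionalR_apply]

theorem universalR_mul_right (q : kˣ) (n : ℕ) (y z z' : QMatrix q n) :
    universalR q n y (z * z') = LinearMap.mul' k k (TensorProduct.map
      ((universalR q n).flip z) ((universalR q n).flip z') (Coalgebra.comul (R := k) y)) := by
  change (universalRAux q n (z * z')) y = _
  rw [map_mul]
  rfl

end UniversalR

section HeckePairs
variable {k : Type u} [Field k] {q : kˣ}

/-- The underlying data of an `A_q(n,n)`-comodule, `n ≥ 1`: a finite dimensional vector space `V`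
and a linear map `V → V ⊗ A_q(n,n)`. -/
structure ComoduleData (q : kˣ) where
  n : ℕ
  one_le_n : 1 ≤ n
  carrier : FGModuleCat.{v} k
  coact : carrier →ₗ[k] carrier ⊗[k] QMatrix q n

/-- The chosen basis of a finite dimensional vector space. -/
abbrev chosenBasis (X : FGModuleCat.{v} k) :
    Module.Basis (Fin (Module.finrank k X)) k X :=
  Module.finBasis k X

/-- The matrix coefficients `t_{ji} ∈ A` of a linear map `f : X → Y ⊗ A`, given by
`f (x_i) = ∑_j y_j ⊗ t_{ji}` on the chosen bases. -/
def matrixCoeff {X Y : FGModuleCat.{v} k} {A : Type u} [Ring A] [Algebra k A]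
    (f : X →ₗ[k] Y ⊗[k] A) (j : Fin (Module.finrank k Y)) (i : Fin (Module.finrank k X)) : A :=
  TensorProduct.lid k A (((chosenBasis Y).coord j).rTensor A (f (chosenBasis X i)))

namespace ComoduleData

/-- The index set of the chosen basis. -/
abbrev Idx (V : ComoduleData.{u, v} q) : Type := Fin (Module.finrank k V.carrier)

/-- `V` is an `A_q(n,n)`-comodule whose coaction takes values in `V ⊗ A_q(n,n)_e`. -/
structure IsHecke (V : ComoduleData.{u, v} q) (e : ℕ) : Prop where
  coassoc : (TensorProduct.assoc k V.carrier (QMatrix q V.n) (QMatrix q V.n)).toLinearMap ∘ₗ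
      V.coact.rTensor (QMatrix q V.n) ∘ₗ V.coact =
    (Coalgebra.comul (R := k) (A := QMatrix q V.n)).lTensor V.carrier ∘ₗ V.coact
  counit : (TensorProduct.rid k V.carrier).toLinearMap ∘ₗ
    (Coalgebra.counit (R := k) (A := QMatrix q V.n)).lTensor V.carrier ∘ₗ V.coact = LinearMap.id
  degree : LinearMap.range V.coact ≤ LinearMap.range
    ((HomAlg.deg (stdR q V.n) (stdR q V.n) e).subtype.lTensor V.carrier)

/-- The `R`-matrix `R_V = (1 ⊗ 1 ⊗ 𝓡)(1 ⊗ τ ⊗ 1)(Δ_V ⊗ Δ_V) τ` of `V`. -/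
def rMatrix (V : ComoduleData.{u, v} q) :
    V.carrier ⊗[k] V.carrier →ₗ[k] V.carrier ⊗[k] V.carrier :=
  (TensorProduct.rid k (V.carrier ⊗[k] V.carrier)).toLinearMap ∘ₗ
    (TensorProduct.lift (universalR q V.n)).lTensor (V.carrier ⊗[k] V.carrier) ∘ₗ
    (TensorProduct.tensorTensorTensorComm k V.carrier (QMatrix q V.n) V.carrier
      (QMatrix q V.n)).toLinearMap ∘ₗ
    TensorProduct.map V.coact V.coact ∘ₗ
    (TensorProduct.comm k V.carrier V.carrier).toLinearMap

/-- The coefficients of `R_V` in the chosen basis. -/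
def R (V : ComoduleData.{u, v} q) : RCoeff k V.Idx := fun a b i j =>
  ((chosenBasis V.carrier).tensorProduct (chosenBasis V.carrier)).repr
    (V.rMatrix (chosenBasis V.carrier i ⊗ₜ chosenBasis V.carrier j)) (a, b)

/-- The tensor power `V^{⊗ d}`. -/
abbrev Pow (V : ComoduleData.{u, v} q) (d : ℕ) : Type (max u v) := ⨂[k] _ : Fin d, V.carrier

/-- The basis `v_{c_1} ⊗ ⋯ ⊗ v_{c_d}` of `V^{⊗ d}`. -/
abbrev powBasis (V : ComoduleData.{u, v} q) (d : ℕ) :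
    Module.Basis (Fin d → V.Idx) k (V.Pow d) :=
  Basis.piTensorProduct fun _ => chosenBasis V.carrier

/-- The action `1 ⊗ R_V ⊗ 1` of a generator of the braid group on `V^{⊗ d}`, with `R_V` acting
on the tensor factors number `s` and `s + 1` (counted from `0`). -/
def braidGen (V : ComoduleData.{u, v} q) (d s : ℕ) (hs : s + 1 < d) : V.Pow d →ₗ[k] V.Pow d :=
  (V.powBasis d).constr k fun c => ∑ a, ∑ b,
    V.R a b (c ⟨s, by omega⟩) (c ⟨s + 1, hs⟩) • V.powBasis d (HomAlg.subst c s hs a b)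

/-- `Hom_{B_d}(V^{⊗ d}, W^{⊗ d})`: the linear maps that commute with the action of the generators
of the braid group. -/
def braidHom (d : ℕ) (V W : ComoduleData.{u, v} q) : Submodule k (V.Pow d →ₗ[k] W.Pow d) where
  carrier := {f | ∀ s hs, f ∘ₗ V.braidGen d s hs = W.braidGen d s hs ∘ₗ f}
  add_mem' := by
    intro f g hf hg s hs
    rw [LinearMap.add_comp, LinearMap.comp_add, hf, hg]
  zero_mem' := by
    intro s hs
    simp
  smul_mem' := by
    intro c f hf s hs
    rw [LinearMap.smul_comp, LinearMap.comp_smul, hf]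

/-- The algebra `A_q(W,V)`. -/
abbrev Alg (W V : ComoduleData.{u, v} q) : Type u := HomAlg W.R V.R

end ComoduleData

/-- An `e`-Hecke pair. -/
structure HeckePair (q : kˣ) (e : ℕ) where
  data : ComoduleData.{u, v} q
  isHecke : data.IsHecke e

/-- The objects of the quantum divided power category `Γ^d_{q,e} 𝒱`: the `e`-Hecke pairs. -/
structure DividedPowerCat (q : kˣ) (d e : ℕ) where
  pair : HeckePair.{u, v} q e

namespace DividedPowerCat

variable {d e : ℕ}

/-- The comodule underlying an object. -/
abbrev data (V : DividedPowerCat.{u, v} q d e) : ComoduleData.{u, v} q := V.pair.data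

instance : Category (DividedPowerCat.{u, v} q d e) where
  Hom V W := ComoduleData.braidHom d V.data W.data
  id V := ⟨LinearMap.id, fun _ _ => rfl⟩
  comp {U V W} f g := ⟨g.1 ∘ₗ f.1, fun s hs => by
    rw [LinearMap.comp_assoc, f.2, ← LinearMap.comp_assoc, g.2, LinearMap.comp_assoc]⟩

instance : Preadditive (DividedPowerCat.{u, v} q d e) where
  homGroup V W := inferInstanceAs (AddCommGroup (ComoduleData.braidHom d V.data W.data))
  add_comp _ _ _ _ _ _ := Subtype.ext (LinearMap.comp_add _ _ _)
  comp_add _ _ _ _ _ _ := Subtype.ext (LinearMap.add_comp _ _ _)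

instance : Linear k (DividedPowerCat.{u, v} q d e) where
  homModule V W := inferInstanceAs (Module k (ComoduleData.braidHom d V.data W.data))
  smul_comp _ _ _ _ _ _ := Subtype.ext (LinearMap.comp_smul _ _ _)
  comp_smul _ _ _ _ _ _ := Subtype.ext (LinearMap.smul_comp _ _ _)

end DividedPowerCat

namespace ComoduleData

variable {d : ℕ}

/-- The linear map `V^{⊗ d} → W^{⊗ d}` whose matrix coefficients are the values of a functional
on `A_q(W,V)_d` at the monomials `x_{j_1 i_1} ⋯ x_{j_d i_d}`. -/
def schurMap (V W : ComoduleData.{u, v} q) (φ : Module.Dual k (HomAlg.deg W.R V.R d)) :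
    V.Pow d →ₗ[k] W.Pow d :=
  (V.powBasis d).constr k fun i => ∑ j : Fin d → W.Idx,
    φ ⟨HomAlg.monomial W.R V.R j i, HomAlg.monomial_mem _ _ _ _⟩ • W.powBasis d j

theorem schurMap_mem (V W : ComoduleData.{u, v} q) (φ : Module.Dual k (HomAlg.deg W.R V.R d)) :
    schurMap V W φ ∈ braidHom d V W := by
  intro s hs
  apply (V.powBasis d).ext
  intro i
  obtain ⟨ψ, hψ⟩ := LinearMap.exists_extend φ
  have hφ : ∀ (j : Fin d → W.Idx) (i : Fin d → V.Idx),
      φ ⟨HomAlg.monomial W.R V.R j i, HomAlg.monomial_mem _ _ _ _⟩ =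
        ψ (HomAlg.monomial W.R V.R j i) := by
    intro j i
    rw [← hψ]
    rfl
  have h1 : ∀ i, schurMap V W φ (V.powBasis d i) =
      ∑ j : Fin d → W.Idx, ψ (HomAlg.monomial W.R V.R j i) • W.powBasis d j := by
    intro i
    rw [schurMap, Module.Basis.constr_basis]
    simp only [hφ]
  have h2 : ∀ (X : ComoduleData.{u, v} q) (c : Fin d → X.Idx),
      X.braidGen d s hs (X.powBasis d c) = ∑ a, ∑ b,
        X.R a b (c ⟨s, by omega⟩) (c ⟨s + 1, hs⟩) • X.powBasis d (HomAlg.subst c s hs a b) := by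
    intro X c
    rw [braidGen, Module.Basis.constr_basis]
  rw [LinearMap.comp_apply, LinearMap.comp_apply, h1, h2]
  simp only [map_sum, map_smul, h1, h2]
  calc _ = ∑ j : Fin d → W.Idx, ψ (∑ a, ∑ b, V.R a b (i ⟨s, by omega⟩) (i ⟨s + 1, hs⟩) •
          HomAlg.monomial W.R V.R j (HomAlg.subst i s hs a b)) • W.powBasis d j := by
        simp only [map_sum, map_smul, Finset.sum_smul, Finset.smul_sum, smul_assoc]
        rw [Finset.sum_comm]
        simp_rw [Finset.sum_comm (s := Finset.univ (α := Fin d → W.Idx))]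
        rw [Finset.sum_comm]
    _ = ∑ j : Fin d → W.Idx, ψ (∑ a, ∑ b, W.R (j ⟨s, by omega⟩) (j ⟨s + 1, hs⟩) a b •
          HomAlg.monomial W.R V.R (HomAlg.subst j s hs a b) i) • W.powBasis d j := by
        simp only [HomAlg.monomial_relation]
    _ = _ := by
        have h := HomAlg.sum_subst s hs fun j j' : Fin d → W.Idx =>
          (W.R (j ⟨s, by omega⟩) (j ⟨s + 1, hs⟩) (j' ⟨s, by omega⟩) (j' ⟨s + 1, hs⟩) *
            ψ (HomAlg.monomial W.R V.R j' i)) • W.powBasis d j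
        simp only [HomAlg.subst_left, HomAlg.subst_right] at h
        simp only [map_sum, map_smul, Finset.sum_smul, Finset.smul_sum, smul_smul, smul_eq_mul]
        rw [h]
        simp only [mul_comm]

/-- The natural map `S_q(V,W;d) = (A_q(W,V)_d)^* → Hom_{B_d}(V^{⊗ d}, W^{⊗ d})`. -/
def schurHom (V W : ComoduleData.{u, v} q) (φ : Module.Dual k (HomAlg.deg W.R V.R d)) :
    braidHom d V W :=
  ⟨schurMap V W φ, schurMap_mem V W φ⟩

end ComoduleData
end HeckePairs

section Functors
variable {k : Type u} [Field k] {q : kˣ} {d e : ℕ}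

/-- The structure map `F''_{V,W} : F(V) → F(W) ⊗ A_q(W,V)_d ⊆ F(W) ⊗ A_q(W,V)` of a functor `F` on
`Γ^d_{q,e} 𝒱`. It is the map adjoint to
`S_q(V,W;d) ≅ Hom_{B_d}(V^{⊗ d}, W^{⊗ d}) → Hom(F(V), F(W))` with `S_q(V,W;d) = (A_q(W,V)_d)^*`;
explicitly `v ↦ ∑_β F(a_β^*)(v) ⊗ a_β` for a basis `a_β` of `A_q(W,V)_d`. -/
def structMap (F : DividedPowerCat.{u, v} q d e ⥤ FGModuleCat.{v} k) (V W : HeckePair.{u, v} q e) :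
    F.obj ⟨V⟩ →ₗ[k] F.obj ⟨W⟩ ⊗[k] W.data.Alg V.data :=
  ∑ β, ((TensorProduct.mk k (F.obj ⟨W⟩) (W.data.Alg V.data)).flip
      (Module.finBasis k (HomAlg.deg W.data.R V.data.R d) β : W.data.Alg V.data)) ∘ₗ
    (F.map (X := ⟨V⟩) (Y := ⟨W⟩) (ComoduleData.schurHom V.data W.data
      ((Module.finBasis k (HomAlg.deg W.data.R V.data.R d)).coord β))).hom.hom

/-- The coassociativity diagram for a family of maps `θ_{V,W} : X(V) → X(W) ⊗ A_q(W,V)`: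
`(θ_{W,U} ⊗ 1) θ_{V,W} = (1 ⊗ Δ_{U,W,V}) θ_{V,U}`. -/
def Coassociative {X : HeckePair.{u, v} q e → FGModuleCat.{v} k}
    (θ : ∀ V W : HeckePair.{u, v} q e, X V →ₗ[k] X W ⊗[k] W.data.Alg V.data) : Prop :=
  ∀ V W U : HeckePair.{u, v} q e,
    (TensorProduct.assoc k (X U) (U.data.Alg W.data) (W.data.Alg V.data)).toLinearMap ∘ₗ
        (θ W U).rTensor (W.data.Alg V.data) ∘ₗ θ V W =
      (HomAlg.comul U.data.R W.data.R V.data.R).toLinearMap.lTensor (X U) ∘ₗ θ V U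

/-- The counit diagram for a family of maps `θ_{V,W} : X(V) → X(W) ⊗ A_q(W,V)`:
`(1 ⊗ e) θ_{V,V} = 1`. -/
def Counital {X : HeckePair.{u, v} q e → FGModuleCat.{v} k}
    (θ : ∀ V W : HeckePair.{u, v} q e, X V →ₗ[k] X W ⊗[k] W.data.Alg V.data) : Prop :=
  ∀ V : HeckePair.{u, v} q e,
    (TensorProduct.rid k (X V)).toLinearMap ∘ₗ
      (HomAlg.counit V.data.R).toLinearMap.lTensor (X V) ∘ₗ θ V V = LinearMap.id

/-- The matrix coefficients of the coaction of `V` satisfy the relations of `A_q(V,V)`, that is,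
`x^V_{ji} ↦ t^V_{ji}` defines an algebra homomorphism `ψ_V : A_q(V,V) → A_q(n,n)`. -/
def PsiWellDefined (V : ComoduleData.{u, v} q) : Prop :=
  SatisfiesRTT V.R V.R (matrixCoeff V.coact)

/-- The homomorphism `ψ_V : A_q(V,V) → A_q(n,n)`, `x^V_{ji} ↦ t^V_{ji}`. -/
def psi (V : ComoduleData.{u, v} q) (hV : PsiWellDefined V) : V.Alg V →ₐ[k] QMatrix q V.n :=
  HomAlg.lift V.R V.R (matrixCoeff V.coact) hV

/-- The vector space `G(V)` with the map `(1 ⊗ ψ_V) G''_{V,V} : G(V) → G(V) ⊗ A_q(n,n)`. -/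
abbrev imageData (G : DividedPowerCat.{u, v} q d e ⥤ FGModuleCat.{v} k) (V : HeckePair.{u, v} q e)
    (hV : PsiWellDefined V.data) : ComoduleData.{u, v} q where
  n := V.data.n
  one_le_n := V.data.one_le_n
  carrier := G.obj ⟨V⟩
  coact := (psi V.data hV).toLinearMap.lTensor (G.obj ⟨V⟩) ∘ₗ structMap G V V

end Functors

end

end QPoly

open QPoly

namespace QPoly

noncomputable section

/-! ### Matrix coefficients of linear maps X → Y ⊗ A. -/

section MatrixCoeff
variable {k : Type u} [Field k]

/-! Everything is read off from matrix coefficients. The coefficients of `R_V` are values of the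
universal form 𝓡 on the coefficients of the coaction (`R_eq_universalR`), so the existence of ψ_V
and of ψ^G is one and the same statement, `exchange_relation`: a matrix T over A(W,V) that Δ splits
through a matrix TW over A(W,W) on the left and a matrix TV over A(V,V) on the right satisfies the
quadratic relations for the R-matrices 𝓡(TW,TW) and 𝓡(TV,TV). For generators these are the defining
relations of A(W,V). Multiplicativity of the form in its second argument, then in its first,
replaces the generators by T. With all three algebras equal to A_q(n,n) this gives ψ_V
(`psiWellDefined`). Then ψ_V is a bialgebra map, 𝓡 pulls back to A(V,V) (`isRForm_pullbackR`), and
the same lemma applied to the coefficients of G'' gives ψ^G (`satisfiesRTT_structMap`).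

On the functor side, contracting F'' with a functional Φ returns F of the morphism defined by Φ
(`contract_structMap`), and composition of morphisms is convolution of functionals along Δ
(`schurLin_convFunctional`). Functoriality therefore amounts to coassociativity and counitality of
the structure maps. The maps ψ^G respect Δ and ε, because on generators this is coassociativity and
counitality of G''. So (F∘G)'' inherits both properties from F''.

To return from structure maps to a functor, morphisms must be the same as functionals on A_q(W,V)_d.
Uniqueness of the functional in degree d holds because monomials span (`schurLin_congr`). Existence
holds because a matrix that commutes with the braid generators defines a functional on words that
respects the quadratic relations (`exists_functional_monomial`, `schurLin_surjective`). Hence a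
coassociative counital family of the right degree comes from exactly one linear functor
(`existsUnique_functor`). -/

theorem rTensor_coord_basis {Y : FGModuleCat.{v} k} {A : Type u} [Ring A] [Algebra k A]
    (j l : Fin (Module.finrank k Y)) (a : A) :
    TensorProduct.lid k A (((chosenBasis Y).coord j).rTensor A (chosenBasis Y l ⊗ₜ a)) =
      if l = j then a else 0 := by
  rw [LinearMap.rTensor_tmul, TensorProduct.lid_tmul, Module.Basis.coord_apply,
    Module.Basis.repr_self, Finsupp.single_apply]
  split_ifs <;> simp

theorem eq_sum_basis_tmul {Y : FGModuleCat.{v} k} {A : Type u} [Ring A] [Algebra k A]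
    (t : Y ⊗[k] A) :
    t = ∑ j, chosenBasis Y j ⊗ₜ
      TensorProduct.lid k A (((chosenBasis Y).coord j).rTensor A t) := by
  induction t with
  | zero => simp
  | add s t hs ht =>
    simp only [map_add, TensorProduct.tmul_add, Finset.sum_add_distrib, ← hs, ← ht]
  | tmul y a =>
    simp only [LinearMap.rTensor_tmul, TensorProduct.lid_tmul, TensorProduct.tmul_smul,
      TensorProduct.smul_tmul', ← TensorProduct.sum_tmul, Module.Basis.coord_apply,
      Module.Basis.sum_repr]

theorem apply_basis {X Y : FGModuleCat.{v} k} {A : Type u} [Ring A] [Algebra k A]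
    (f : X →ₗ[k] Y ⊗[k] A) (i : Fin (Module.finrank k X)) :
    f (chosenBasis X i) = ∑ j, chosenBasis Y j ⊗ₜ matrixCoeff f j i :=
  eq_sum_basis_tmul _

theorem matrixCoeff_eq_of_apply_basis {X Y : FGModuleCat.{v} k} {A : Type u} [Ring A]
    [Algebra k A] {f : X →ₗ[k] Y ⊗[k] A}
    {t : Fin (Module.finrank k Y) → Fin (Module.finrank k X) → A}
    (h : ∀ i, f (chosenBasis X i) = ∑ j, chosenBasis Y j ⊗ₜ t j i) : matrixCoeff f = t := by
  funext j i
  simp only [matrixCoeff, h, map_sum, rTensor_coord_basis]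
  simp

theorem ext_matrixCoeff {X Y : FGModuleCat.{v} k} {A : Type u} [Ring A] [Algebra k A]
    {f g : X →ₗ[k] Y ⊗[k] A} (h : matrixCoeff f = matrixCoeff g) : f = g := by
  apply (chosenBasis X).ext
  intro i
  rw [apply_basis, apply_basis, h]

theorem matrixCoeff_lTensor {X Y : FGModuleCat.{v} k} {A B : Type u} [Ring A] [Algebra k A]
    [Ring B] [Algebra k B] (ψ : A →ₗ[k] B) (f : X →ₗ[k] Y ⊗[k] A) :
    matrixCoeff (ψ.lTensor Y ∘ₗ f) = fun j i => ψ (matrixCoeff f j i) := by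
  apply matrixCoeff_eq_of_apply_basis
  intro i
  rw [LinearMap.comp_apply, apply_basis, map_sum]
  rfl

/-- Compare the coefficients of the basis vectors of Z. Three spaces and three algebras are allowed,
so that the criterion serves both for coactions and for families of structure maps. -/
theorem comodule_coassoc_iff {X Y Z : FGModuleCat.{v} k} {A B C : Type u} [Ring A] [Algebra k A]
    [Ring B] [Algebra k B] [Ring C] [Algebra k C] (f : X →ₗ[k] Y ⊗[k] B) (g : Y →ₗ[k] Z ⊗[k] A)
    (h : X →ₗ[k] Z ⊗[k] C) (Δ : C →ₗ[k] A ⊗[k] B) :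
    (TensorProduct.assoc k Z A B).toLinearMap ∘ₗ g.rTensor B ∘ₗ f = Δ.lTensor Z ∘ₗ h ↔
      ∀ l i, Δ (matrixCoeff h l i) = ∑ j, matrixCoeff g l j ⊗ₜ matrixCoeff f j i := by
  have e1 : ∀ i, ((TensorProduct.assoc k Z A B).toLinearMap ∘ₗ g.rTensor B ∘ₗ f)
      (chosenBasis X i) = ∑ l, chosenBasis Z l ⊗ₜ (∑ j, matrixCoeff g l j ⊗ₜ[k]
        matrixCoeff f j i) := by
    intro i
    simp only [LinearMap.comp_apply, apply_basis, map_sum, LinearMap.rTensor_tmul,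
      TensorProduct.sum_tmul, TensorProduct.tmul_sum, LinearEquiv.coe_coe,
      TensorProduct.assoc_tmul]
    exact Finset.sum_comm
  have e2 : ∀ i, (Δ.lTensor Z ∘ₗ h) (chosenBasis X i) =
      ∑ l, chosenBasis Z l ⊗ₜ Δ (matrixCoeff h l i) := by
    intro i
    simp only [LinearMap.comp_apply, apply_basis, map_sum, LinearMap.lTensor_tmul]
  constructor
  · intro H l i
    have e3 := congrArg (fun t => TensorProduct.lid k (A ⊗[k] B)
      (((chosenBasis Z).coord l).rTensor (A ⊗[k] B) t)) ((e2 i).symm.trans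
        ((LinearMap.congr_fun H _).symm.trans (e1 i)))
    simp only [map_sum, rTensor_coord_basis] at e3
    simpa using e3
  · intro H
    apply (chosenBasis X).ext
    intro i
    rw [e1, e2]
    simp only [H]

theorem comodule_counit_iff {X : FGModuleCat.{v} k} {A : Type u} [Ring A] [Algebra k A]
    (f : X →ₗ[k] X ⊗[k] A) (ε : A →ₗ[k] k) :
    (TensorProduct.rid k X).toLinearMap ∘ₗ ε.lTensor X ∘ₗ f = LinearMap.id ↔
      ∀ j i, ε (matrixCoeff f j i) = if j = i then 1 else 0 := by
  have e1 : ∀ i, ((TensorProduct.rid k X).toLinearMap ∘ₗ ε.lTensor X ∘ₗ f) (chosenBasis X i) =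
      ∑ j, ε (matrixCoeff f j i) • chosenBasis X j := by
    intro i
    simp only [LinearMap.comp_apply, apply_basis, map_sum, LinearMap.lTensor_tmul,
      LinearEquiv.coe_coe, TensorProduct.rid_tmul]
  constructor
  · intro H j i
    have := congrArg (fun x => (chosenBasis X).repr x j) (e1 i)
    rw [H] at this
    simpa [Finsupp.single_apply, eq_comm] using this.symm
  · intro H
    apply (chosenBasis X).ext
    intro i
    rw [e1]
    simp [H]

theorem range_le_lTensor_iff {X Y : FGModuleCat.{v} k} {A : Type u} [Ring A] [Algebra k A]
    (f : X →ₗ[k] Y ⊗[k] A) (N : Submodule k A) :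
    LinearMap.range f ≤ LinearMap.range (N.subtype.lTensor Y) ↔ ∀ j i, matrixCoeff f j i ∈ N := by
  constructor
  · intro H j i
    obtain ⟨t, ht⟩ := H ⟨chosenBasis X i, rfl⟩
    rw [matrixCoeff, ← ht]
    clear ht
    induction t with
    | zero => simp
    | add s t hs ht => simp only [map_add]; exact N.add_mem hs ht
    | tmul y a =>
      simp only [LinearMap.lTensor_tmul, LinearMap.rTensor_tmul, TensorProduct.lid_tmul]
      exact N.smul_mem _ a.2
  · rintro H _ ⟨x, rfl⟩
    rw [← (chosenBasis X).sum_repr x, map_sum]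
    refine Submodule.sum_mem _ fun i _ => ?_
    rw [map_smul, apply_basis]
    refine Submodule.smul_mem _ _ (Submodule.sum_mem _ fun j _ => ?_)
    exact ⟨chosenBasis Y j ⊗ₜ ⟨_, H j i⟩, rfl⟩

end MatrixCoeff

/-! ### Universal R-forms and the exchange relations. -/

section Exchange
variable {k : Type u} [Field k]

/-- Apply a functional to the left tensor factor. -/
def sliceLeft {A C : Type u} [Ring A] [Algebra k A] [Ring C] [Algebra k C] (f : A →ₗ[k] k) :
    A ⊗[k] C →ₗ[k] C :=
  (TensorProduct.lid k C).toLinearMap ∘ₗ f.rTensor C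

/-- Apply a functional to the right tensor factor. -/
def sliceRight {A C : Type u} [Ring A] [Algebra k A] [Ring C] [Algebra k C] (f : A →ₗ[k] k) :
    C ⊗[k] A →ₗ[k] C :=
  (TensorProduct.rid k C).toLinearMap ∘ₗ f.lTensor C

section Slice
variable {A C : Type u} [Ring A] [Algebra k A] [Ring C] [Algebra k C]

@[simp] theorem sliceLeft_tmul (f : A →ₗ[k] k) (a : A) (c : C) :
    sliceLeft f (a ⊗ₜ[k] c) = f a • c := rfl

@[simp] theorem sliceRight_tmul (f : A →ₗ[k] k) (a : A) (c : C) :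
    sliceRight f (c ⊗ₜ[k] a) = f a • c := rfl

/-- The factors g and h are kept separate so that the lemma covers both representations, with
entries f_{pc}(a) f_{cb}(b), and antirepresentations, where the two entries trade places. -/
theorem sliceLeft_mul {α : Type*} [Fintype α] {f : A →ₗ[k] k} {g h : α → A →ₗ[k] k}
    (H : ∀ a b, f (a * b) = ∑ c, g c a * h c b) (s t : A ⊗[k] C) :
    sliceLeft f (s * t) = ∑ c, sliceLeft (g c) s * sliceLeft (h c) t := by
  induction s with
  | zero => simp
  | add s s' hs hs' => simp only [add_mul, map_add, hs, hs', Finset.sum_add_distrib]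
  | tmul a x =>
    induction t with
    | zero => simp
    | add t t' ht ht' => simp only [mul_add, map_add, ht, ht', Finset.sum_add_distrib]
    | tmul b y =>
      simp only [Algebra.TensorProduct.tmul_mul_tmul, sliceLeft_tmul, H, Finset.sum_smul,
        smul_mul_smul_comm]

theorem sliceRight_mul {α : Type*} [Fintype α] {f : A →ₗ[k] k} {g h : α → A →ₗ[k] k}
    (H : ∀ a b, f (a * b) = ∑ c, g c a * h c b) (s t : C ⊗[k] A) :
    sliceRight f (s * t) = ∑ c, sliceRight (g c) s * sliceRight (h c) t := by
  induction s with
  | zero => simp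
  | add s s' hs hs' => simp only [add_mul, map_add, hs, hs', Finset.sum_add_distrib]
  | tmul x a =>
    induction t with
    | zero => simp
    | add t t' ht ht' => simp only [mul_add, map_add, ht, ht', Finset.sum_add_distrib]
    | tmul y b =>
      simp only [Algebra.TensorProduct.tmul_mul_tmul, sliceRight_tmul, H, Finset.sum_smul,
        smul_mul_smul_comm]

end Slice

variable {ι κ : Type} [Fintype ι] [Fintype κ]
  {RW : RCoeff k ι} {RV : RCoeff k κ}

/-- If a matrix `T` over `A(W,V)` intertwines two representations by slices on generators, then
it intertwines them everywhere. -/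
theorem slice_intertwine {α β : Type} [Fintype α] [Fintype β] [DecidableEq α] [DecidableEq β]
    (fW : α → α → HomAlg RW RW →ₗ[k] k) (fV : β → β → HomAlg RV RV →ₗ[k] k)
    (T : α → β → HomAlg RW RV)
    (oneW : ∀ p b, fW p b 1 = if p = b then 1 else 0)
    (oneV : ∀ p b, fV p b 1 = if p = b then 1 else 0)
    (mulW : ∀ p b y z, fW p b (y * z) = ∑ c, fW p c y * fW c b z)
    (mulV : ∀ p b y z, fV p b (y * z) = ∑ c, fV p c y * fV c b z)
    (hgen : ∀ p j r i, ∑ b, sliceLeft (fW p b) (HomAlg.comul RW RW RV (HomAlg.gen RW RV r i)) *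
      T b j = ∑ b, T p b *
        sliceRight (fV b j) (HomAlg.comul RW RV RV (HomAlg.gen RW RV r i)))
    (z : HomAlg RW RV) : ∀ p j, ∑ b, sliceLeft (fW p b) (HomAlg.comul RW RW RV z) * T b j =
      ∑ b, T p b * sliceRight (fV b j) (HomAlg.comul RW RV RV z) := by
  induction z using gen_induction with
  | one =>
    intro p j
    simp [Algebra.TensorProduct.one_def, oneW, oneV]
  | gen r i => exact fun p j => hgen p j r i
  | mul y z hy hz =>
    intro p j
    simp only [map_mul, sliceLeft_mul (mulW _ _), sliceRight_mul (mulV _ _)]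
    -- The slices of a product are matrix products, so T is moved past the slices of z and then past
    -- those of y.
    calc _ = ∑ c, sliceLeft (fW p c) (HomAlg.comul RW RW RV y) *
          ∑ b, sliceLeft (fW c b) (HomAlg.comul RW RW RV z) * T b j := by
          simp only [Finset.sum_mul, Finset.mul_sum, mul_assoc]
          exact Finset.sum_comm
      _ = ∑ b, (∑ c, sliceLeft (fW p c) (HomAlg.comul RW RW RV y) * T c b) *
            sliceRight (fV b j) (HomAlg.comul RW RV RV z) := by
          simp only [hz, Finset.sum_mul, Finset.mul_sum, mul_assoc]
          exact Finset.sum_comm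
      _ = _ := by
          simp only [hy, Finset.sum_mul, Finset.mul_sum, mul_assoc]
          exact Finset.sum_comm
  | add y z hy hz =>
    intro p j
    simp only [map_add, add_mul, mul_add, Finset.sum_add_distrib, hy, hz]
  | smul c y hy =>
    intro p j
    simp only [map_smul, smul_mul_assoc, mul_smul_comm, ← Finset.smul_sum, hy]

/-- The version of `slice_intertwine` for antirepresentations. -/
theorem slice_intertwine_op {α β : Type} [Fintype α] [Fintype β] [DecidableEq α] [DecidableEq β]
    (fW : α → α → HomAlg RW RW →ₗ[k] k) (fV : β → β → HomAlg RV RV →ₗ[k] k)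
    (T : α → β → HomAlg RW RV)
    (oneW : ∀ p b, fW p b 1 = if p = b then 1 else 0)
    (oneV : ∀ p b, fV p b 1 = if p = b then 1 else 0)
    (mulW : ∀ p b y z, fW p b (y * z) = ∑ c, fW c b y * fW p c z)
    (mulV : ∀ p b y z, fV p b (y * z) = ∑ c, fV c b y * fV p c z)
    (hgen : ∀ r i p j, ∑ a, T a i *
        sliceLeft (fW r a) (HomAlg.comul RW RW RV (HomAlg.gen RW RV p j)) =
      ∑ a, sliceRight (fV a i) (HomAlg.comul RW RV RV (HomAlg.gen RW RV p j)) * T r a)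
    (y : HomAlg RW RV) : ∀ r i, ∑ a, T a i * sliceLeft (fW r a) (HomAlg.comul RW RW RV y) =
      ∑ a, sliceRight (fV a i) (HomAlg.comul RW RV RV y) * T r a := by
  induction y using gen_induction with
  | one =>
    intro p j
    simp [Algebra.TensorProduct.one_def, oneW, oneV]
  | gen p j => exact fun r i => hgen r i p j
  | mul y z hy hz =>
    intro r i
    simp only [map_mul, sliceLeft_mul (mulW _ _), sliceRight_mul (mulV _ _)]
    calc _ = ∑ c, (∑ a, T a i * sliceLeft (fW c a) (HomAlg.comul RW RW RV y)) *
          sliceLeft (fW r c) (HomAlg.comul RW RW RV z) := by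
          simp only [Finset.sum_mul, Finset.mul_sum, mul_assoc]
          exact Finset.sum_comm
      _ = ∑ a, sliceRight (fV a i) (HomAlg.comul RW RV RV y) *
            ∑ c, T c a * sliceLeft (fW r c) (HomAlg.comul RW RW RV z) := by
          simp only [hy, Finset.sum_mul, Finset.mul_sum, mul_assoc]
          exact Finset.sum_comm
      _ = _ := by
          simp only [hz, Finset.sum_mul, Finset.mul_sum, mul_assoc]
          exact Finset.sum_comm
  | add y z hy hz =>
    intro p j
    simp only [map_add, add_mul, mul_add, Finset.sum_add_distrib, hy, hz]
  | smul c y hy =>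
    intro p j
    simp only [map_smul, smul_mul_assoc, mul_smul_comm, ← Finset.smul_sum, hy]

/-- A universal `R`-form on the bialgebra `A(V,V)` with values `R^{ia}_{bj}` on the pairs of
generators. -/
structure IsRForm [DecidableEq ι] (R : RCoeff k ι)
    (r : HomAlg R R →ₗ[k] HomAlg R R →ₗ[k] k) : Prop where
  gen_gen : ∀ i j a b, r (HomAlg.gen R R i j) (HomAlg.gen R R a b) = R i a b j
  one_left : ∀ z, r 1 z = HomAlg.counit R z
  one_right : ∀ y, r y 1 = HomAlg.counit R y
  mul_right : ∀ y z z', r y (z * z') =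
    LinearMap.mul' k k (TensorProduct.map (r.flip z) (r.flip z') (HomAlg.comul R R R y))
  mul_left : ∀ y y' z, r (y * y') z =
    LinearMap.mul' k k (TensorProduct.map (r y') (r y) (HomAlg.comul R R R z))

/-- A matrix over `A(V,V)` whose entries are the matrix coefficients of a comodule. -/
structure IsMultiplicative [DecidableEq ι] {α : Type} [Fintype α] [DecidableEq α] (R : RCoeff k ι)
    (T : α → α → HomAlg R R) : Prop where
  comul_eq : ∀ i j, HomAlg.comul R R R (T i j) = ∑ l, T i l ⊗ₜ[k] T l j
  counit_eq : ∀ i j, HomAlg.counit R (T i j) = if i = j then 1 else 0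

theorem IsMultiplicative.gen [DecidableEq ι] (R : RCoeff k ι) :
    IsMultiplicative R (HomAlg.gen R R) :=
  ⟨HomAlg.comul_gen R R R, HomAlg.counit_gen R⟩

namespace IsRForm
variable [DecidableEq ι] {R : RCoeff k ι} {r : HomAlg R R →ₗ[k] HomAlg R R →ₗ[k] k}
  {α : Type} [Fintype α] [DecidableEq α] {T : α → α → HomAlg R R}

theorem mul_right_matrix (hr : IsRForm R r) (hT : IsMultiplicative R T) (p b : α)
    (y z : HomAlg R R) : r (T p b) (y * z) = ∑ c, r (T p c) y * r (T c b) z := by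
  simp [hr.mul_right, hT.comul_eq]

/-- The form reverses products in its first argument, so fixing a comodule matrix in the second
argument gives an antirepresentation, in contrast to `mul_right_matrix`. -/
theorem mul_left_matrix (hr : IsRForm R r) (hT : IsMultiplicative R T) (p b : α)
    (y z : HomAlg R R) : r (y * z) (T p b) = ∑ c, r y (T c b) * r z (T p c) := by
  simp [hr.mul_left, hT.comul_eq, mul_comm]

end IsRForm

/-- Matrices of coefficients satisfy the exchange relations for the `R`-matrices obtained from
universal `R`-forms. -/
theorem exchange_relation [DecidableEq ι] [DecidableEq κ]
    {rW : HomAlg RW RW →ₗ[k] HomAlg RW RW →ₗ[k] k} (hW : IsRForm RW rW)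
    {rV : HomAlg RV RV →ₗ[k] HomAlg RV RV →ₗ[k] k} (hV : IsRForm RV rV)
    {α β : Type} [Fintype α] [Fintype β] [DecidableEq α] [DecidableEq β]
    {TW : α → α → HomAlg RW RW} (hTW : IsMultiplicative RW TW)
    {TV : β → β → HomAlg RV RV} (hTV : IsMultiplicative RV TV) {T : α → β → HomAlg RW RV}
    (hl : ∀ i j, HomAlg.comul RW RW RV (T i j) = ∑ l, TW i l ⊗ₜ[k] T l j)
    (hr : ∀ i j, HomAlg.comul RW RV RV (T i j) = ∑ l, T i l ⊗ₜ[k] TV l j) :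
    SatisfiesRTT (fun p r a b => rW (TW p b) (TW r a)) (fun a b i j => rV (TV a j) (TV b i)) T := by
  -- Generators in the first argument of the form, an arbitrary element z in the second: on
  -- generators z this is the defining relation of A(W,V).
  have h1 : ∀ z p j, ∑ b, sliceLeft (rW (HomAlg.gen RW RW p b)) (HomAlg.comul RW RW RV z) *
      HomAlg.gen RW RV b j = ∑ b, HomAlg.gen RW RV p b *
        sliceRight (rV (HomAlg.gen RV RV b j)) (HomAlg.comul RW RV RV z) := by
    refine slice_intertwine (fun p b => rW (HomAlg.gen RW RW p b))
      (fun p b => rV (HomAlg.gen RV RV p b)) (HomAlg.gen RW RV) ?_ ?_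
      (hW.mul_right_matrix (.gen RW)) (hV.mul_right_matrix (.gen RV)) ?_
    · intro p b
      rw [hW.one_right, HomAlg.counit_gen]
    · intro p b
      rw [hV.one_right, HomAlg.counit_gen]
    · intro p j r i
      have h := HomAlg.satisfiesRTT_gen RW RV p r i j
      simp only [HomAlg.comul_gen, map_sum, sliceLeft_tmul, sliceRight_tmul, Finset.sum_mul,
        Finset.mul_sum, smul_mul_assoc, mul_smul_comm, hW.gen_gen, hV.gen_gen]
      rw [Finset.sum_comm, h]
  -- Now TW and TV stand in the second argument and an arbitrary y in the first; the claim is the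
  -- case where y is an entry of T.
  have h2 : ∀ y r i, ∑ a, T a i * sliceLeft (rW.flip (TW r a)) (HomAlg.comul RW RW RV y) =
      ∑ a, sliceRight (rV.flip (TV a i)) (HomAlg.comul RW RV RV y) * T r a := by
    refine slice_intertwine_op (fun r a => rW.flip (TW r a)) (fun r a => rV.flip (TV r a)) T ?_ ?_
      (hW.mul_left_matrix hTW) (hV.mul_left_matrix hTV) ?_
    · intro p b
      rw [LinearMap.flip_apply, hW.one_left, hTW.counit_eq]
    · intro p b
      rw [LinearMap.flip_apply, hV.one_left, hTV.counit_eq]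
    · intro r i p j
      -- `h1` at an entry of T, with Δ expanded by `hl` and `hr`, is the generator case y = x_{pj}
      -- needed here.
      have h := h1 (T r i) p j
      rw [hl, hr] at h
      simp only [HomAlg.comul_gen, map_sum, sliceLeft_tmul, sliceRight_tmul, Finset.sum_mul,
        Finset.mul_sum, smul_mul_assoc, mul_smul_comm, LinearMap.flip_apply] at h ⊢
      rw [Finset.sum_comm, h]
      exact Finset.sum_comm
  intro p r i j
  have h := h2 (T p j) r i
  rw [hl, hr] at h
  simp only [map_sum, sliceLeft_tmul, sliceRight_tmul, Finset.sum_mul,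
    Finset.mul_sum, smul_mul_assoc, mul_smul_comm, LinearMap.flip_apply] at h
  exact h.trans Finset.sum_comm

end Exchange

/-! ### 𝓡 is a universal R-form on A_q(n,n). -/

section UniversalForm
variable {k : Type u} [Field k]

theorem exists_comul_eq_sum {ι : Type} [Fintype ι] (R : RCoeff k ι) (y : HomAlg R R) :
    ∃ S : Finset (HomAlg R R × HomAlg R R), HomAlg.comul R R R y = ∑ i ∈ S, i.1 ⊗ₜ[k] i.2 :=
  TensorProduct.exists_finset _

theorem universalR_one_right (q : kˣ) (n : ℕ) (y : QMatrix q n) :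
    universalR q n y 1 = HomAlg.counit (stdR q n) y := by
  change universalRAux q n 1 y = _
  rw [map_one, LinearMap.convOne_apply]
  rfl

/-- The construction of 𝓡 provides multiplicativity in the second argument; the rule for the first
is proved by induction on z. For a generator z it says that `matrixR` takes values in the opposite
matrix algebra. -/
theorem universalR_mul_left (q : kˣ) (n : ℕ) (z : QMatrix q n) : ∀ y y' : QMatrix q n,
    universalR q n (y * y') z = LinearMap.mul' k k (TensorProduct.map (universalR q n y')
      (universalR q n y) (HomAlg.comul (stdR q n) (stdR q n) (stdR q n) z)) := by
  have hmul : ∀ y z z', universalR q n y (z * z') = LinearMap.mul' k k (TensorProduct.map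
      ((universalR q n).flip z) ((universalR q n).flip z')
      (HomAlg.comul (stdR q n) (stdR q n) (stdR q n) y)) := universalR_mul_right q n
  induction z using gen_induction with
  | one =>
    intro y y'
    simp [Algebra.TensorProduct.one_def, universalR_one_right, mul_comm]
  | gen a b =>
    intro y y'
    have h : ∀ y a b, universalR q n y (HomAlg.gen _ _ a b) = functionalR q n a b y := by
      intro y a b
      change universalRAux q n (HomAlg.gen _ _ a b) y = _
      rw [show universalRAux q n (HomAlg.gen _ _ a b) = functionalR q n a b from
        HomAlg.lift_gen _ _ _ _ _ _]
    simp only [HomAlg.comul_gen, map_sum, TensorProduct.map_tmul, LinearMap.mul'_apply, h,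
      functionalR_apply, map_mul, MulOpposite.unop_mul, Matrix.mul_apply]
  | mul z z' hz hz' =>
    intro y y'
    obtain ⟨Sy, ey⟩ := exists_comul_eq_sum (stdR q n) y
    obtain ⟨Sy', ey'⟩ := exists_comul_eq_sum (stdR q n) y'
    obtain ⟨Sz, ez⟩ := exists_comul_eq_sum (stdR q n) z
    obtain ⟨Sz', ez'⟩ := exists_comul_eq_sum (stdR q n) z'
    have hm : ∀ a b : HomAlg (stdR q n) (stdR q n),
      HomAlg.comul (stdR q n) (stdR q n) (stdR q n) (a * b) = _ := map_mul _
    simp only [hmul, hm, ey, ey', ez, ez', Finset.sum_mul_sum,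
      Algebra.TensorProduct.tmul_mul_tmul, map_sum, TensorProduct.map_tmul,
      LinearMap.mul'_apply, LinearMap.flip_apply, hz, hz']
    simp only [← Finset.sum_product']
    -- Both sides are sums of the same four-fold products 𝓡(y'₁,z₁) 𝓡(y₁,z₂) 𝓡(y'₂,z'₁) 𝓡(y₂,z'₂).
    -- The left is indexed in the order y, y', z, z', the right in the order z, z', y', y.
    refine Finset.sum_nbij' (fun x => (x.2.2.1, x.2.2.2, x.2.1, x.1))
      (fun x => (x.2.2.2, x.2.2.1, x.1, x.2.1)) ?_ ?_ ?_ ?_ ?_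
    · intro x hx; simp only [Finset.mem_product] at hx ⊢; tauto
    · intro x hx; simp only [Finset.mem_product] at hx ⊢; tauto
    · intro x _; rfl
    · intro x _; rfl
    · intro x _; ring
  | add z z' hz hz' => intro y y'; simp only [map_add, hz, hz']
  | smul c z hz => intro y y'; simp only [map_smul, hz]

theorem isRForm_universalR (q : kˣ) (n : ℕ) : IsRForm (stdR q n) (universalR q n) where
  gen_gen := universalR_gen_gen q n
  one_left z := by
    induction z using gen_induction with
    | one => exact universalR_one_right q n 1
    | gen a b =>
      change (universalRAux q n (HomAlg.gen _ _ a b)) 1 = _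
      rw [show universalRAux q n (HomAlg.gen _ _ a b) = functionalR q n a b from
        HomAlg.lift_gen _ _ _ _ _ _]
      simp [functionalR_apply, Matrix.one_apply]
    | mul z z' hz hz' =>
      rw [universalR_mul_right, Bialgebra.comul_one, Algebra.TensorProduct.one_def]
      simp [hz, hz']
    | add z z' hz hz' => simp only [map_add, hz, hz']
    | smul c z hz => simp only [map_smul, hz]
  one_right := universalR_one_right q n
  mul_right := universalR_mul_right q n
  mul_left y y' z := universalR_mul_left q n z y y'

end UniversalForm

/-! ### Hecke pairs: the R-matrix, ψ_V and the pulled back form. -/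

section Hecke
variable {k : Type u} [Field k] {q : kˣ}

/-- The lower indices i and j appear in exchanged positions because `rMatrix` begins with the flip.
-/
theorem R_eq_universalR (V : ComoduleData.{u, v} q) (a b i j : V.Idx) :
    V.R a b i j = universalR q V.n (matrixCoeff V.coact a j) (matrixCoeff V.coact b i) := by
  simp only [ComoduleData.R, ComoduleData.rMatrix, LinearMap.comp_apply, LinearEquiv.coe_coe,
    TensorProduct.comm_tmul, TensorProduct.map_tmul, apply_basis, TensorProduct.sum_tmul,
    TensorProduct.tmul_sum, map_sum, TensorProduct.tensorTensorTensorComm_tmul,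
    LinearMap.lTensor_tmul, TensorProduct.lift.tmul, TensorProduct.rid_tmul, map_smul,
    Finsupp.finsetSum_apply, Finsupp.smul_apply, Module.Basis.tensorProduct_repr_tmul_apply,
    Module.Basis.repr_self, Finsupp.single_apply]
  simp

theorem isMultiplicative_coact {e : ℕ} (V : ComoduleData.{u, v} q) (hV : V.IsHecke e) :
    IsMultiplicative (stdR q V.n) (matrixCoeff V.coact) where
  comul_eq := (comodule_coassoc_iff V.coact V.coact V.coact
    (HomAlg.comul (stdR q V.n) (stdR q V.n) (stdR q V.n)).toLinearMap).1 hV.coassoc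
  counit_eq := (comodule_counit_iff V.coact (HomAlg.counit (stdR q V.n)).toLinearMap).1 hV.counit

/-- The case of `exchange_relation` in which the three algebras are A_q(n,n) and the three matrices
are the coefficients of the coaction. -/
theorem psiWellDefined {e : ℕ} (V : ComoduleData.{u, v} q) (hV : V.IsHecke e) :
    PsiWellDefined V := by
  have h := exchange_relation (isRForm_universalR q V.n) (isRForm_universalR q V.n)
    (isMultiplicative_coact V hV) (isMultiplicative_coact V hV)
    (isMultiplicative_coact V hV).comul_eq (isMultiplicative_coact V hV).comul_eq
  intro p r i j
  simpa only [R_eq_universalR] using h p r i j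

section Psi
variable {e : ℕ} (V : ComoduleData.{u, v} q) (hψ : PsiWellDefined V)

@[simp] theorem psi_gen (i j : V.Idx) :
    psi V hψ (HomAlg.gen V.R V.R i j) = matrixCoeff V.coact i j :=
  HomAlg.lift_gen _ _ _ _ _ _

theorem comul_psi (hV : V.IsHecke e) (y : V.Alg V) :
    HomAlg.comul (stdR q V.n) (stdR q V.n) (stdR q V.n) (psi V hψ y) =
      TensorProduct.map (psi V hψ).toLinearMap (psi V hψ).toLinearMap
        (HomAlg.comul V.R V.R V.R y) := by
  have : (HomAlg.comul (stdR q V.n) (stdR q V.n) (stdR q V.n)).comp (psi V hψ) =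
      (Algebra.TensorProduct.map (psi V hψ) (psi V hψ)).comp (HomAlg.comul V.R V.R V.R) := by
    apply HomAlg.algHom_ext
    intro j i
    simp [(isMultiplicative_coact V hV).comul_eq]
  exact DFunLike.congr_fun this y

theorem counit_psi (hV : V.IsHecke e) (y : V.Alg V) :
    HomAlg.counit (stdR q V.n) (psi V hψ y) = HomAlg.counit V.R y := by
  have : (HomAlg.counit (stdR q V.n)).comp (psi V hψ) = HomAlg.counit V.R := by
    apply HomAlg.algHom_ext
    intro j i
    simp [(isMultiplicative_coact V hV).counit_eq]
  exact DFunLike.congr_fun this y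

end Psi

/-- The universal `R`-form of `A_q(n,n)`, pulled back to `A_q(V,V)`. -/
def pullbackR (V : ComoduleData.{u, v} q) (hψ : PsiWellDefined V) :
    V.Alg V →ₗ[k] V.Alg V →ₗ[k] k :=
  (universalR q V.n).compl₁₂ (psi V hψ).toLinearMap (psi V hψ).toLinearMap

@[simp] theorem pullbackR_apply (V : ComoduleData.{u, v} q) (hψ : PsiWellDefined V)
    (y z : V.Alg V) : pullbackR V hψ y z = universalR q V.n (psi V hψ y) (psi V hψ z) := rfl

/-- ψ_V is a bialgebra map, so the axioms pull back; the values on generators are those of `R_V` by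
`R_eq_universalR`. This places the form on A_q(V,V) itself, so that V and W may be comodules over
A_q(n,n) for different n. -/
theorem isRForm_pullbackR {e : ℕ} (V : ComoduleData.{u, v} q) (hV : V.IsHecke e)
    (hψ : PsiWellDefined V) : IsRForm V.R (pullbackR V hψ) where
  gen_gen i j a b := by simp [R_eq_universalR]
  one_left z := by
    rw [pullbackR_apply, map_one, (isRForm_universalR q V.n).one_left, counit_psi V hψ hV]
  one_right z := by
    rw [pullbackR_apply, map_one, (isRForm_universalR q V.n).one_right, counit_psi V hψ hV]
  mul_right y z z' := by
    rw [pullbackR_apply, map_mul, (isRForm_universalR q V.n).mul_right, comul_psi V hψ hV,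
      ← LinearMap.comp_apply (TensorProduct.map _ _), ← TensorProduct.map_comp]
    rfl
  mul_left y y' z := by
    rw [pullbackR_apply, map_mul, (isRForm_universalR q V.n).mul_left, comul_psi V hψ hV,
      ← LinearMap.comp_apply (TensorProduct.map _ _), ← TensorProduct.map_comp]
    rfl

end Hecke

/-! ### Functionals on words, and the monomials of A(W,V). -/

section Words
variable {k : Type u} [Field k] {ι κ μ : Type}

theorem basisFreeMonoid_apply {X : Type} (L : List X) :
    FreeAlgebra.basisFreeMonoid k X (FreeMonoid.ofList L) =
      (L.map (FreeAlgebra.ι k)).prod := by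
  simp [FreeAlgebra.basisFreeMonoid, FreeAlgebra.equivMonoidAlgebraFreeMonoid,
    FreeMonoid.lift_apply]

/-- A functional on the words of length `d` in the generators, as a function of all words. -/
def wordCoeff {d : ℕ} (c : (Fin d → ι) → (Fin d → κ) → k) (L : List (ι × κ)) : k :=
  if h : L.length = d then
    c (fun s => (L.get (Fin.cast h.symm s)).1) (fun s => (L.get (Fin.cast h.symm s)).2) else 0

/-- The functional on the free algebra given by a function of the words of length `d`. -/
def wordFunctional {d : ℕ} (c : (Fin d → ι) → (Fin d → κ) → k) : FreeAlgebra k (ι × κ) →ₗ[k] k :=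
  (FreeAlgebra.basisFreeMonoid k (ι × κ)).constr k fun w => wordCoeff c w.toList

theorem wordFunctional_word {d : ℕ} (c : (Fin d → ι) → (Fin d → κ) → k) (L : List (ι × κ)) :
    wordFunctional c (L.map (FreeAlgebra.ι k)).prod = wordCoeff c L := by
  rw [← basisFreeMonoid_apply, wordFunctional, Module.Basis.constr_basis]
  rfl

theorem wordCoeff_ofFn {d : ℕ} (c : (Fin d → ι) → (Fin d → κ) → k) (j : Fin d → ι)
    (i : Fin d → κ) : wordCoeff c (List.ofFn fun s => (j s, i s)) = c j i := by
  rw [wordCoeff, dif_pos (by simp)]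
  congr <;> simp

variable [Fintype ι] [Fintype κ] [Fintype μ]

/-- The compatibility of a matrix on multi-indices with the quadratic relations. -/
def CommutesWithR (RW : RCoeff k ι) (RV : RCoeff k κ) {d : ℕ}
    (c : (Fin d → ι) → (Fin d → κ) → k) : Prop :=
  ∀ s (hs : s + 1 < d) j i,
    ∑ a, ∑ b, RW (j ⟨s, by omega⟩) (j ⟨s + 1, hs⟩) a b * c (HomAlg.subst j s hs a b) i =
      ∑ a, ∑ b, RV a b (i ⟨s, by omega⟩) (i ⟨s + 1, hs⟩) * c j (HomAlg.subst i s hs a b)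

/-- In length d this is `CommutesWithR` at the position s = `L.length`, where the relation is
inserted. -/
theorem wordCoeff_relation {RW : RCoeff k ι} {RV : RCoeff k κ} {d : ℕ}
    {c : (Fin d → ι) → (Fin d → κ) → k} (hc : CommutesWithR RW RV c)
    (L L' : List (ι × κ)) (p r : ι) (i j : κ) :
    ∑ a, ∑ b, RW p r a b * wordCoeff c (L ++ (a, i) :: (b, j) :: L') =
      ∑ a, ∑ b, RV a b i j * wordCoeff c (L ++ (p, a) :: (r, b) :: L') := by
  by_cases hd : L.length + (L'.length + 2) = d
  · subst hd
    have hs : L.length + 1 < L.length + (L'.length + 2) := by omega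
    have hl : ∀ x y : ι × κ, (L ++ x :: y :: L').length = L.length + (L'.length + 2) := by
      intro x y; simp
    have h := hc L.length hs
      (fun s => ((L ++ (p, i) :: (r, j) :: L').get (Fin.cast (hl _ _).symm s)).1)
      (fun s => ((L ++ (p, i) :: (r, j) :: L').get (Fin.cast (hl _ _).symm s)).2)
    -- Words that share the prefix L and the suffix L' differ only at positions `L.length` and
    -- `L.length + 1`, which is where `subst` acts.
    have hget : ∀ (x y z w : ι × κ) (s : Fin (L.length + (L'.length + 2))),
        (L ++ x :: y :: L').get (Fin.cast (hl _ _).symm s) =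
          if s = ⟨L.length + 1, hs⟩ then y else if s = ⟨L.length, by omega⟩ then x else
            (L ++ z :: w :: L').get (Fin.cast (hl _ _).symm s) := by
      intro x y z w s
      obtain ⟨s, hs'⟩ := s
      simp only [List.get_eq_getElem, Fin.val_cast, List.getElem_append, List.getElem_cons,
        Fin.mk.injEq]
      grind
    have e1 : ∀ a b, wordCoeff c (L ++ (a, i) :: (b, j) :: L') = c
        (HomAlg.subst (fun s => ((L ++ (p, i) :: (r, j) :: L').get
          (Fin.cast (hl _ _).symm s)).1) L.length hs a b)
        (fun s => ((L ++ (p, i) :: (r, j) :: L').get (Fin.cast (hl _ _).symm s)).2) := by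
      intro a b
      rw [wordCoeff, dif_pos (hl _ _)]
      congr 1
      · funext s
        rw [hget (a, i) (b, j) (p, i) (r, j)]
        simp only [HomAlg.subst, Function.update_apply]
        split_ifs <;> rfl
      · funext s
        rw [hget (a, i) (b, j) (p, i) (r, j), hget (p, i) (r, j) (p, i) (r, j)]
        split_ifs <;> rfl
    have e2 : ∀ a b, wordCoeff c (L ++ (p, a) :: (r, b) :: L') = c
        (fun s => ((L ++ (p, i) :: (r, j) :: L').get (Fin.cast (hl _ _).symm s)).1)
        (HomAlg.subst (fun s => ((L ++ (p, i) :: (r, j) :: L').get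
          (Fin.cast (hl _ _).symm s)).2) L.length hs a b) := by
      intro a b
      rw [wordCoeff, dif_pos (hl _ _)]
      congr 1
      · funext s
        rw [hget (p, a) (r, b) (p, i) (r, j), hget (p, i) (r, j) (p, i) (r, j)]
        split_ifs <;> rfl
      · funext s
        rw [hget (p, a) (r, b) (p, i) (r, j)]
        simp only [HomAlg.subst, Function.update_apply]
        split_ifs <;> rfl
    simp only [e1, e2]
    simpa using h
  -- In any other length all terms vanish by the default value of `wordCoeff`.
  · have h0 : ∀ x y, wordCoeff c (L ++ x :: y :: L') = 0 := by
      intro x y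
      rw [wordCoeff, dif_neg]
      simpa using hd
    simp only [h0, mul_zero, Finset.sum_const_zero]

theorem wordFunctional_relation {RW : RCoeff k ι} {RV : RCoeff k κ} {d : ℕ}
    {c : (Fin d → ι) → (Fin d → κ) → k} (hc : CommutesWithR RW RV c) (p r : ι) (i j : κ)
    (y z : FreeAlgebra k (ι × κ)) :
    wordFunctional c (y * (∑ a, ∑ b, RW p r a b •
        (FreeAlgebra.ι k (a, i) * FreeAlgebra.ι k (b, j))) * z) =
      wordFunctional c (y * (∑ a, ∑ b, RV a b i j •
        (FreeAlgebra.ι k (p, a) * FreeAlgebra.ι k (r, b))) * z) := by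
  suffices h : ∀ s t : FreeAlgebra k (ι × κ),
      (∀ L L' : List (ι × κ), wordFunctional c ((L.map (FreeAlgebra.ι k)).prod * s *
        (L'.map (FreeAlgebra.ι k)).prod) = wordFunctional c ((L.map (FreeAlgebra.ι k)).prod * t *
        (L'.map (FreeAlgebra.ι k)).prod)) →
      ∀ y z, wordFunctional c (y * s * z) = wordFunctional c (y * t * z) by
    refine h _ _ (fun L L' => ?_) y z
    have e : ∀ x y : ι × κ, wordFunctional c ((L.map (FreeAlgebra.ι k)).prod *
        (FreeAlgebra.ι k x * FreeAlgebra.ι k y) * (L'.map (FreeAlgebra.ι k)).prod) =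
          wordCoeff c (L ++ x :: y :: L') := by
      intro x y
      rw [← wordFunctional_word]
      simp [mul_assoc]
    simp only [Finset.mul_sum, Finset.sum_mul, mul_smul_comm, smul_mul_assoc, map_sum, map_smul,
      e, smul_eq_mul]
    exact wordCoeff_relation hc L L' p r i j
  intro s t h y z
  -- `B s` is the bilinear form (y, z) ↦ Φ(y s z), so it suffices to compare forms on the basis of
  -- words.
  let B : FreeAlgebra k (ι × κ) → FreeAlgebra k (ι × κ) →ₗ[k] FreeAlgebra k (ι × κ) →ₗ[k] k :=
    fun s => ((LinearMap.mul k (FreeAlgebra k (ι × κ))).compr₂ (wordFunctional c)).comp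
      (LinearMap.mulRight k s)
  suffices hB : B s = B t from LinearMap.congr_fun₂ hB y z
  refine (FreeAlgebra.basisFreeMonoid k (ι × κ)).ext fun w =>
    (FreeAlgebra.basisFreeMonoid k (ι × κ)).ext fun w' => ?_
  have := h w.toList w'.toList
  rw [← basisFreeMonoid_apply, ← basisFreeMonoid_apply] at this
  exact this

/-- The elements which a functional does not distinguish, even after multiplication. -/
def functionalCon {A : Type u} [Ring A] [Algebra k A] (Φ : A →ₗ[k] k) : RingCon A where
  r x y := ∀ a b, Φ (a * x * b) = Φ (a * y * b)
  iseqv := ⟨fun _ _ _ => rfl, fun h a b => (h a b).symm, fun h h' a b => (h a b).trans (h' a b)⟩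
  mul' := by
    intro w x y z h h' a b
    have e1 := h a (y * b)
    have e2 := h' (a * x) b
    simp only [mul_assoc] at e1 e2 ⊢
    exact e1.trans e2
  add' := by
    intro w x y z h h' a b
    simp only [mul_add, add_mul, map_add, h a b, h' a b]

/-- The functional induced on the quotient. -/
def functionalConDesc {A : Type u} [Ring A] [Algebra k A] (Φ : A →ₗ[k] k) :
    (functionalCon Φ).Quotient →ₗ[k] k where
  toFun := Quotient.lift Φ fun x y (h : ∀ a b, Φ (a * x * b) = Φ (a * y * b)) => by
    simpa using h 1 1
  map_add' := by
    rintro ⟨x⟩ ⟨y⟩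
    exact map_add Φ x y
  map_smul' := by
    rintro r ⟨x⟩
    exact map_smul Φ r x

/-- The word functional must be shown to factor through A(W,V). It factors through the quotient by
`functionalCon`, and there the generators satisfy the quadratic relations by
`wordFunctional_relation`; the universal property of A(W,V) then maps it to this quotient. -/
theorem exists_functional_monomial {RW : RCoeff k ι} {RV : RCoeff k κ} {d : ℕ}
    {c : (Fin d → ι) → (Fin d → κ) → k} (hc : CommutesWithR RW RV c) :
    ∃ Φ : HomAlg RW RV →ₗ[k] k, ∀ j i, Φ (HomAlg.monomial RW RV j i) = c j i := by
  let π : FreeAlgebra k (ι × κ) →ₐ[k] (functionalCon (wordFunctional c)).Quotient :=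
    (functionalCon (wordFunctional c)).mkₐ k
  have ht : SatisfiesRTT RW RV fun j i => π (FreeAlgebra.ι k (j, i)) := by
    intro p r i j
    simp only [← map_mul, ← map_smul, ← map_sum]
    exact Quotient.sound (wordFunctional_relation hc p r i j)
  refine ⟨functionalConDesc (wordFunctional c) ∘ₗ (HomAlg.lift RW RV _ ht).toLinearMap, ?_⟩
  intro j i
  have h1 : HomAlg.lift RW RV _ ht (HomAlg.monomial RW RV j i) =
      π ((List.ofFn fun s => (j s, i s)).map (FreeAlgebra.ι k)).prod := by
    rw [HomAlg.monomial, map_list_prod, map_list_prod, List.map_ofFn, List.map_map, List.map_ofFn]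
    congr 2
    funext s
    simp
  rw [LinearMap.comp_apply, AlgHom.toLinearMap_apply, h1, ← wordCoeff_ofFn c j i,
    ← wordFunctional_word]
  rfl

/-- Δ is multiplicative, so the inner indices of the single letters assemble into one inner
multi-index. Functionals on monomials thereby convolve like matrices. -/
theorem comul_monomial (RV : RCoeff k ι) (RW : RCoeff k κ) (RU : RCoeff k μ) {d : ℕ}
    (j : Fin d → ι) (i : Fin d → μ) :
    HomAlg.comul RV RW RU (HomAlg.monomial RV RU j i) =
      ∑ l : Fin d → κ, HomAlg.monomial RV RW j l ⊗ₜ[k] HomAlg.monomial RW RU l i := by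
  induction d with
  | zero => simp [HomAlg.monomial, Algebra.TensorProduct.one_def]
  | succ d ih =>
    have e : ∀ {ι κ : Type} [Fintype ι] [Fintype κ] (R : RCoeff k ι) (S : RCoeff k κ)
        (j : Fin (d + 1) → ι) (i : Fin (d + 1) → κ), HomAlg.monomial R S j i =
          HomAlg.gen R S (j 0) (i 0) * HomAlg.monomial R S (Fin.tail j) (Fin.tail i) := by
      intro ι κ _ _ R S j i
      rw [HomAlg.monomial, List.ofFn_succ, List.prod_cons]
      rfl
    rw [e, map_mul, ih, HomAlg.comul_gen, Finset.sum_mul_sum, ← Fintype.sum_prod_type']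
    refine Fintype.sum_equiv (Fin.consEquiv fun _ => κ) _ _ fun x => ?_
    simp [e, Fin.consEquiv]

theorem counit_monomial [DecidableEq ι] (R : RCoeff k ι) {d : ℕ} (j i : Fin d → ι) :
    HomAlg.counit R (HomAlg.monomial R R j i) = if j = i then 1 else 0 := by
  rw [HomAlg.monomial, map_list_prod, List.map_ofFn, List.prod_ofFn]
  simp only [Function.comp_apply, HomAlg.counit_gen]
  by_cases h : j = i
  · simp [h]
  · obtain ⟨s, hs⟩ := Function.ne_iff.1 h
    rw [if_neg h]
    exact Finset.prod_eq_zero (Finset.mem_univ s) (if_neg hs)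

theorem deg_eq_span_monomial (RW : RCoeff k ι) (RV : RCoeff k κ) (d : ℕ) :
    HomAlg.deg RW RV d = Submodule.span k
      (Set.range fun x : (Fin d → ι) × (Fin d → κ) => HomAlg.monomial RW RV x.1 x.2) := by
  rw [HomAlg.deg, Submodule.span_pow]
  congr 1
  ext y
  rw [Set.mem_pow]
  constructor
  · rintro ⟨f, rfl⟩
    choose g hg using fun s => (f s).2
    refine ⟨(fun s => (g s).1, fun s => (g s).2), ?_⟩
    simp only [HomAlg.monomial, hg]
  · rintro ⟨x, rfl⟩
    exact ⟨fun s => ⟨_, (x.1 s, x.2 s), rfl⟩, rfl⟩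

/-- The degree d part is the d-th power of the span of the generators, and algebra homomorphisms
preserve powers of submodules. -/
theorem lift_mem_deg {ι' κ' : Type} [Fintype ι'] [Fintype κ'] {RW : RCoeff k ι} {RV : RCoeff k κ}
    {RW' : RCoeff k ι'} {RV' : RCoeff k κ'} {t : ι → κ → HomAlg RW' RV'}
    (ht : SatisfiesRTT RW RV t) {m : ℕ} (hm : ∀ j i, t j i ∈ HomAlg.deg RW' RV' m) {d : ℕ}
    {y : HomAlg RW RV} (hy : y ∈ HomAlg.deg RW RV d) :
    HomAlg.lift RW RV t ht y ∈ HomAlg.deg RW' RV' (d * m) := by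
  have h : (HomAlg.deg RW RV d).map (HomAlg.lift RW RV t ht).toLinearMap ≤
      HomAlg.deg RW' RV' m ^ d := by
    rw [HomAlg.deg, Submodule.map_pow]
    refine pow_le_pow_left' ?_ d
    rw [Submodule.map_span, Submodule.span_le]
    rintro _ ⟨_, ⟨x, rfl⟩, rfl⟩
    simpa using hm x.1 x.2
  have := h (Submodule.mem_map_of_mem hy)
  rwa [HomAlg.deg, ← pow_mul, mul_comm] at this

end Words

/-! ### Morphisms of the divided power category as functionals on A_q(W,V). -/

section Schur
variable {k : Type u} [Field k] {q : kˣ} {d : ℕ}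

/-- The map `V^{⊗ d} → W^{⊗ d}` defined by a functional on all of `A_q(W,V)`, as an element of
`Hom_{B_d}(V^{⊗ d}, W^{⊗ d})` that depends linearly on the functional. -/
def schurLin (d : ℕ) (V W : ComoduleData.{u, v} q) :
    (W.Alg V →ₗ[k] k) →ₗ[k] ComoduleData.braidHom d V W where
  toFun Φ := ComoduleData.schurHom V W (Φ ∘ₗ (HomAlg.deg W.R V.R d).subtype)
  map_add' Φ Ψ := by
    apply Subtype.ext
    apply (V.powBasis d).ext
    intro i
    simp only [ComoduleData.schurHom, ComoduleData.schurMap, Submodule.coe_add,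
      LinearMap.add_apply, Module.Basis.constr_basis, LinearMap.comp_apply, add_smul,
      Finset.sum_add_distrib]
  map_smul' c Φ := by
    apply Subtype.ext
    apply (V.powBasis d).ext
    intro i
    simp only [ComoduleData.schurHom, ComoduleData.schurMap, Submodule.coe_smul,
      LinearMap.smul_apply, Module.Basis.constr_basis, LinearMap.comp_apply, smul_assoc,
      Finset.smul_sum, RingHom.id_apply]

theorem schurLin_apply_basis (V W : ComoduleData.{u, v} q) (Φ : W.Alg V →ₗ[k] k)
    (i : Fin d → V.Idx) : (schurLin d V W Φ).1 (V.powBasis d i) =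
      ∑ j : Fin d → W.Idx, Φ (HomAlg.monomial W.R V.R j i) • W.powBasis d j := by
  simp only [schurLin, LinearMap.coe_mk, AddHom.coe_mk, ComoduleData.schurHom,
    ComoduleData.schurMap, Module.Basis.constr_basis, LinearMap.comp_apply,
    Submodule.subtype_apply]

/-- The matrix entries of the morphism are the values of the functional at monomials, and these span
degree d. -/
theorem schurLin_congr (V W : ComoduleData.{u, v} q) {Φ Ψ : W.Alg V →ₗ[k] k}
    (h : schurLin d V W Φ = schurLin d V W Ψ) {y : W.Alg V} (hy : y ∈ HomAlg.deg W.R V.R d) :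
    Φ y = Ψ y := by
  rw [deg_eq_span_monomial] at hy
  induction hy using Submodule.span_induction with
  | mem _ h' =>
    obtain ⟨⟨j, i⟩, rfl⟩ := h'
    have e := congrArg (fun f => (W.powBasis d).repr (f.1 (V.powBasis d i)) j) h
    simp only [schurLin_apply_basis, map_sum, map_smul, Module.Basis.repr_self,
      Finsupp.finsetSum_apply, Finsupp.smul_apply, Finsupp.single_apply] at e
    simpa using e
  | zero => simp
  | add _ _ _ _ h1 h2 => rw [map_add, map_add, h1, h2]
  | smul c _ _ h1 => rw [map_smul, map_smul, h1]

/-- Commuting with the braid generators is, entry by entry, the condition `CommutesWithR`, so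
`exists_functional_monomial` supplies the functional. -/
theorem schurLin_surjective (d : ℕ) (V W : ComoduleData.{u, v} q) :
    Function.Surjective (schurLin d V W) := by
  intro f
  have hf : ∀ i, f.1 (V.powBasis d i) =
      ∑ j, (W.powBasis d).repr (f.1 (V.powBasis d i)) j • W.powBasis d j :=
    fun i => ((W.powBasis d).sum_repr _).symm
  have hX : ∀ (X : ComoduleData.{u, v} q) (s : ℕ) (hs : s + 1 < d) (c : Fin d → X.Idx),
      X.braidGen d s hs (X.powBasis d c) = ∑ a, ∑ b,
        X.R a b (c ⟨s, by omega⟩) (c ⟨s + 1, hs⟩) • X.powBasis d (HomAlg.subst c s hs a b) := by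
    intro X s hs c
    rw [ComoduleData.braidGen, Module.Basis.constr_basis]
  have hc : CommutesWithR W.R V.R
      (fun (j : Fin d → W.Idx) i => (W.powBasis d).repr (f.1 (V.powBasis d i)) j) := by
    intro s hs j i
    generalize ht : (fun (j : Fin d → W.Idx) i =>
      (W.powBasis d).repr (f.1 (V.powBasis d i)) j) = t at hf ⊢
    have ht' : ∀ i j, (W.powBasis d).repr (f.1 (V.powBasis d i)) j = t j i := by
      intro i j; rw [← ht]
    simp only [ht'] at hf
    have e := congrArg (fun y => (W.powBasis d).repr y j)
      (LinearMap.congr_fun (f.2 s hs) (V.powBasis d i))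
    -- Reindexing moves the substitution from the basis vectors of the target to the coefficients,
    -- the form in which `CommutesWithR` has it.
    have h := HomAlg.sum_subst s hs fun j' j'' : Fin d → W.Idx =>
          (W.R (j' ⟨s, by omega⟩) (j' ⟨s + 1, hs⟩) (j'' ⟨s, by omega⟩) (j'' ⟨s + 1, hs⟩) *
            t j'' i) • W.powBasis d j'
    simp only [HomAlg.subst_left, HomAlg.subst_right] at h
    simp only [LinearMap.comp_apply, hX, map_sum, map_smul, ht', Finsupp.finsetSum_apply,
      Finsupp.smul_apply, smul_eq_mul] at e
    rw [e]
    have e' : W.braidGen d s hs (f.1 (V.powBasis d i)) = ∑ j' : Fin d → W.Idx, ∑ a, ∑ b,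
        (W.R (j' ⟨s, by omega⟩) (j' ⟨s + 1, hs⟩) a b * t (HomAlg.subst j' s hs a b) i) •
          W.powBasis d j' := by
      rw [h, hf]
      simp only [map_sum, map_smul, hX, Finset.smul_sum, smul_smul, mul_comm]
    rw [e']
    simp only [map_sum, map_smul, Module.Basis.repr_self, Finsupp.finsetSum_apply,
      Finsupp.smul_apply, Finsupp.single_apply]
    simp_rw [← Finset.sum_smul]
    simp
  obtain ⟨Φ, hΦ⟩ := exists_functional_monomial hc
  refine ⟨Φ, ?_⟩
  apply Subtype.ext
  apply (V.powBasis d).ext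
  intro i
  rw [schurLin_apply_basis, hf]
  simp only [hΦ]

/-- The convolution of functionals along `Δ_{U,W,V}`. -/
def convFunctional (U W V : ComoduleData.{u, v} q) (Φ : U.Alg W →ₗ[k] k)
    (Ψ : W.Alg V →ₗ[k] k) : U.Alg V →ₗ[k] k :=
  LinearMap.mul' k k ∘ₗ TensorProduct.map Φ Ψ ∘ₗ (HomAlg.comul U.R W.R V.R).toLinearMap

theorem schurLin_convFunctional (U W V : ComoduleData.{u, v} q) (Φ : U.Alg W →ₗ[k] k)
    (Ψ : W.Alg V →ₗ[k] k) : (schurLin d V U (convFunctional U W V Φ Ψ)).1 =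
      (schurLin d W U Φ).1 ∘ₗ (schurLin d V W Ψ).1 := by
  apply (V.powBasis d).ext
  intro i
  simp only [LinearMap.comp_apply, schurLin_apply_basis, map_sum, map_smul, convFunctional,
    AlgHom.toLinearMap_apply, comul_monomial, TensorProduct.map_tmul, LinearMap.mul'_apply,
    Finset.sum_smul, Finset.smul_sum, smul_smul]
  rw [Finset.sum_comm]
  simp only [mul_comm]

theorem schurLin_counit (V : ComoduleData.{u, v} q) :
    (schurLin d V V (HomAlg.counit V.R).toLinearMap).1 = LinearMap.id := by
  apply (V.powBasis d).ext
  intro i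
  simp [schurLin_apply_basis, counit_monomial, -Basis.piTensorProduct_apply]

end Schur

/-! ### Contraction of coefficients with functionals. -/

section Contract
variable {k : Type u} [Field k]

/-- Apply a functional to the coefficients of `f : X → Y ⊗ A`. -/
def contract {X Y : FGModuleCat.{v} k} {A : Type u} [Ring A] [Algebra k A] (Φ : A →ₗ[k] k)
    (f : X →ₗ[k] Y ⊗[k] A) : X →ₗ[k] Y :=
  (TensorProduct.rid k Y).toLinearMap ∘ₗ Φ.lTensor Y ∘ₗ f

theorem contract_basis {X Y : FGModuleCat.{v} k} {A : Type u} [Ring A] [Algebra k A]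
    (Φ : A →ₗ[k] k) (f : X →ₗ[k] Y ⊗[k] A) (i : Fin (Module.finrank k X)) :
    contract Φ f (chosenBasis X i) = ∑ j, Φ (matrixCoeff f j i) • chosenBasis Y j := by
  simp only [contract, LinearMap.comp_apply, apply_basis, map_sum, LinearMap.lTensor_tmul,
    LinearEquiv.coe_coe, TensorProduct.rid_tmul]

theorem coord_contract_basis {X Y : FGModuleCat.{v} k} {A : Type u} [Ring A] [Algebra k A]
    (Φ : A →ₗ[k] k) (f : X →ₗ[k] Y ⊗[k] A) (j : Fin (Module.finrank k Y))
    (i : Fin (Module.finrank k X)) :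
    (chosenBasis Y).repr (contract Φ f (chosenBasis X i)) j = Φ (matrixCoeff f j i) := by
  rw [contract_basis, Module.Basis.repr_sum_self]

theorem ext_contract {X Y : FGModuleCat.{v} k} {A : Type u} [Ring A] [Algebra k A]
    {f g : X →ₗ[k] Y ⊗[k] A} (h : ∀ Φ : A →ₗ[k] k, contract Φ f = contract Φ g) : f = g := by
  apply ext_matrixCoeff
  funext j i
  rw [← sub_eq_zero, ← Module.forall_dual_apply_eq_zero_iff k]
  intro Φ
  rw [map_sub, ← coord_contract_basis, ← coord_contract_basis, h, sub_self]

/-- A tensor is determined by the values of products of functionals. -/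
theorem tmul_ext_functional {A B : Type*} [AddCommGroup A] [Module k A] [AddCommGroup B]
    [Module k B] {s t : A ⊗[k] B} (h : ∀ (Φ : A →ₗ[k] k) (Ψ : B →ₗ[k] k),
      LinearMap.mul' k k (TensorProduct.map Φ Ψ s) =
        LinearMap.mul' k k (TensorProduct.map Φ Ψ t)) : s = t := by
  -- Coordinates in a product basis are products of coordinate functionals; A and B need not be
  -- finite dimensional.
  let bA := Module.Basis.ofVectorSpace k A
  let bB := Module.Basis.ofVectorSpace k B
  have hr : ∀ (s : A ⊗[k] B) x, (bA.tensorProduct bB).repr s x =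
      LinearMap.mul' k k (TensorProduct.map (bA.coord x.1) (bB.coord x.2) s) := by
    intro s x
    induction s with
    | zero => simp
    | add s t hs ht => simp only [map_add, Finsupp.add_apply, hs, ht]
    | tmul a b =>
      rw [Module.Basis.tensorProduct_repr_tmul_apply]
      simp [mul_comm]
  apply (bA.tensorProduct bB).ext_elem
  intro x
  rw [hr, hr, h]

end Contract

/-! ### Structure maps of a functor: coassociativity and counit. -/

section StructMap
variable {k : Type u} [Field k] {q : kˣ} {d e : ℕ}

theorem map_comp_apply (F : DividedPowerCat.{u, v} q d e ⥤ FGModuleCat.{v} k)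
    {V W U : DividedPowerCat.{u, v} q d e} (f : V ⟶ W) (g : W ⟶ U) :
    (F.map (f ≫ g)).hom.hom = (F.map g).hom.hom ∘ₗ (F.map f).hom.hom := by
  rw [F.map_comp]
  rfl

theorem structMap_range (F : DividedPowerCat.{u, v} q d e ⥤ FGModuleCat.{v} k)
    (V W : HeckePair.{u, v} q e) : LinearMap.range (structMap F V W) ≤
    LinearMap.range ((HomAlg.deg W.data.R V.data.R d).subtype.lTensor (F.obj ⟨W⟩)) := by
  rintro _ ⟨x, rfl⟩
  simp only [structMap, LinearMap.sum_apply]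
  exact Submodule.sum_mem _ fun β _ => ⟨_ ⊗ₜ Module.finBasis k _ β, rfl⟩

theorem matrixCoeff_structMap_mem (F : DividedPowerCat.{u, v} q d e ⥤ FGModuleCat.{v} k)
    (V W : HeckePair.{u, v} q e) (j i) :
    matrixCoeff (structMap F V W) j i ∈ HomAlg.deg W.data.R V.data.R d :=
  (range_le_lTensor_iff _ _).1 (structMap_range F V W) j i

variable (F : DividedPowerCat.{u, v} q d e ⥤ FGModuleCat.{v} k) [F.Additive] [F.Linear k]

/-- The action of `F` on the morphisms given by functionals on `A_q(W,V)`. -/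
def functorAction (V W : HeckePair.{u, v} q e) :
    (W.data.Alg V.data →ₗ[k] k) →ₗ[k] F.obj ⟨V⟩ →ₗ[k] F.obj ⟨W⟩ where
  toFun Φ := (F.map (X := ⟨V⟩) (Y := ⟨W⟩) (schurLin d V.data W.data Φ)).hom.hom
  map_add' Φ Ψ := by
    rw [map_add]
    exact congrArg (fun f => f.hom.hom) (F.map_add (X := ⟨V⟩) (Y := ⟨W⟩)
      (f := schurLin d V.data W.data Φ) (g := schurLin d V.data W.data Ψ))
  map_smul' c Φ := by
    rw [map_smul]
    exact congrArg (fun f => f.hom.hom) (F.map_smul (X := ⟨V⟩) (Y := ⟨W⟩)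
      c (schurLin d V.data W.data Φ))

theorem functorAction_apply (V W : HeckePair.{u, v} q e) (Φ : W.data.Alg V.data →ₗ[k] k) :
    functorAction F V W Φ =
      (F.map (X := ⟨V⟩) (Y := ⟨W⟩) (schurLin d V.data W.data Φ)).hom.hom := rfl

theorem functorAction_congr {V W : HeckePair.{u, v} q e} {Φ Ψ : W.data.Alg V.data →ₗ[k] k}
    (h : ∀ y ∈ HomAlg.deg W.data.R V.data.R d, Φ y = Ψ y) :
    functorAction F V W Φ = functorAction F V W Ψ := by
  have : Φ ∘ₗ (HomAlg.deg W.data.R V.data.R d).subtype =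
      Ψ ∘ₗ (HomAlg.deg W.data.R V.data.R d).subtype := LinearMap.ext fun y => h y y.2
  simp only [functorAction_apply, schurLin, LinearMap.coe_mk, AddHom.coe_mk, this]

theorem functorAction_convFunctional (V W U : HeckePair.{u, v} q e)
    (Φ : U.data.Alg W.data →ₗ[k] k) (Ψ : W.data.Alg V.data →ₗ[k] k) :
    functorAction F V U (convFunctional U.data W.data V.data Φ Ψ) =
      functorAction F W U Φ ∘ₗ functorAction F V W Ψ := by
  have h : schurLin d V.data U.data (convFunctional U.data W.data V.data Φ Ψ) =
      CategoryStruct.comp (obj := DividedPowerCat q d e) (X := ⟨V⟩) (Y := ⟨W⟩) (Z := ⟨U⟩)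
        (schurLin d V.data W.data Ψ) (schurLin d W.data U.data Φ) :=
    Subtype.ext (schurLin_convFunctional _ _ _ _ _)
  rw [functorAction_apply, h, map_comp_apply]
  rfl

theorem functorAction_counit (V : HeckePair.{u, v} q e) :
    functorAction F V V (HomAlg.counit V.data.R).toLinearMap = LinearMap.id := by
  have h : schurLin d V.data V.data (HomAlg.counit V.data.R).toLinearMap =
      CategoryStruct.id (obj := DividedPowerCat q d e) ⟨V⟩ :=
    Subtype.ext (schurLin_counit _)
  rw [functorAction_apply, h, F.map_id]
  rfl

/-- This frees the structure map from the basis in its definition: on A_q(W,V)_d, Φ equals ∑_β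
Φ(a_β) a_β^*, and F is linear on morphisms. -/
theorem contract_structMap (V W : HeckePair.{u, v} q e) (Φ : W.data.Alg V.data →ₗ[k] k) :
    contract Φ (structMap F V W) = functorAction F V W Φ := by
  set b := Module.finBasis k (HomAlg.deg W.data.R V.data.R d) with hb
  -- The dual basis lives on the degree d part only; any extension to A_q(W,V) will do, by
  -- `functorAction_congr`.
  choose Ψ hΨ using fun β => LinearMap.exists_extend (b.coord β)
  have h1 : ∀ β, (F.map (X := ⟨V⟩) (Y := ⟨W⟩)
      (ComoduleData.schurHom V.data W.data (b.coord β))).hom.hom = functorAction F V W (Ψ β) := by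
    intro β
    rw [← hΨ β]
    rfl
  have h2 : functorAction F V W Φ = ∑ β, Φ (b β) • functorAction F V W (Ψ β) := by
    have h3 : functorAction F V W Φ = functorAction F V W (∑ β, Φ (b β) • Ψ β) := by
      refine functorAction_congr F fun y hy => ?_
      have h4 : ∀ β, Ψ β y = b.coord β ⟨y, hy⟩ := fun β => by rw [← hΨ β]; rfl
      conv_lhs => rw [show y = ((⟨y, hy⟩ : HomAlg.deg W.data.R V.data.R d) : W.data.Alg V.data)
        from rfl, ← b.sum_repr ⟨y, hy⟩]
      simp only [Submodule.coe_sum, Submodule.coe_smul, map_sum, map_smul, LinearMap.sum_apply,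
        LinearMap.smul_apply, h4, Module.Basis.coord_apply, smul_eq_mul]
      exact Finset.sum_congr rfl fun _ _ => mul_comm _ _
    rw [h3]
    simp only [map_sum, map_smul]
  rw [h2]
  ext x
  simp only [contract, structMap, ← hb, h1, LinearMap.comp_apply, LinearMap.sum_apply, map_sum,
    LinearMap.flip_apply, TensorProduct.mk_apply, LinearMap.lTensor_tmul, LinearEquiv.coe_coe,
    TensorProduct.rid_tmul, LinearMap.smul_apply]

/-- Test both sides on a product of functionals Φ and Ψ. The left side becomes an entry of the
action of their convolution, which by functoriality is a composite, and the right side is the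
corresponding matrix product. -/
theorem comul_matrixCoeff_structMap (V W U : HeckePair.{u, v} q e) (l i) :
    HomAlg.comul U.data.R W.data.R V.data.R (matrixCoeff (structMap F V U) l i) =
      ∑ j, matrixCoeff (structMap F W U) l j ⊗ₜ[k] matrixCoeff (structMap F V W) j i := by
  apply tmul_ext_functional
  intro Φ Ψ
  change convFunctional U.data W.data V.data Φ Ψ _ = _
  rw [← coord_contract_basis, contract_structMap, functorAction_convFunctional,
    ← contract_structMap, ← contract_structMap, LinearMap.comp_apply, contract_basis]
  simp only [map_sum, map_smul, Finsupp.finsetSum_apply, Finsupp.smul_apply,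
    coord_contract_basis, TensorProduct.map_tmul, LinearMap.mul'_apply, smul_eq_mul, mul_comm]

theorem counit_matrixCoeff_structMap (V : HeckePair.{u, v} q e) (j i) :
    HomAlg.counit V.data.R (matrixCoeff (structMap F V V) j i) = if j = i then 1 else 0 := by
  have := coord_contract_basis (HomAlg.counit V.data.R).toLinearMap (structMap F V V) j i
  rw [contract_structMap, functorAction_counit] at this
  rw [← AlgHom.toLinearMap_apply, ← this]
  simp [Finsupp.single_apply, eq_comm]

end StructMap

/-! ### The Hecke pair G(V) and the relations behind ψ^G. -/

section Composition
variable {k : Type u} [Field k] {q : kˣ} {d e : ℕ}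

theorem matrixCoeff_imageData (G : DividedPowerCat.{u, v} q d e ⥤ FGModuleCat.{v} k)
    (V : HeckePair.{u, v} q e) (hV : PsiWellDefined V.data) :
    matrixCoeff (imageData G V hV).coact =
      fun j i => psi V.data hV (matrixCoeff (structMap G V V) j i) :=
  matrixCoeff_lTensor (psi V.data hV).toLinearMap (structMap G V V)

/-- The R-matrix of G(V) is thus already visible in A_q(V,V), before passing to A_q(n,n). -/
theorem imageData_R (G : DividedPowerCat.{u, v} q d e ⥤ FGModuleCat.{v} k)
    (V : HeckePair.{u, v} q e) (hV : PsiWellDefined V.data) (a b i j) :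
    (imageData G V hV).R a b i j = pullbackR V.data hV (matrixCoeff (structMap G V V) a j)
      (matrixCoeff (structMap G V V) b i) := by
  rw [R_eq_universalR, matrixCoeff_imageData]
  rfl

variable (G : DividedPowerCat.{u, v} q d e ⥤ FGModuleCat.{v} k) [G.Additive] [G.Linear k]

theorem isMultiplicative_structMap (V : HeckePair.{u, v} q e) :
    IsMultiplicative V.data.R (matrixCoeff (structMap G V V)) :=
  ⟨comul_matrixCoeff_structMap G V V V, counit_matrixCoeff_structMap G V⟩

theorem imageData_isHecke (V : HeckePair.{u, v} q e) (hV : PsiWellDefined V.data) :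
    (imageData G V hV).IsHecke (d * e) where
  coassoc := by
    refine (comodule_coassoc_iff (imageData G V hV).coact (imageData G V hV).coact
      (imageData G V hV).coact (HomAlg.comul (stdR q V.data.n) (stdR q V.data.n)
        (stdR q V.data.n)).toLinearMap).2 fun l i => ?_
    rw [matrixCoeff_imageData, AlgHom.toLinearMap_apply, comul_psi V.data hV V.isHecke,
      comul_matrixCoeff_structMap, map_sum]
    rfl
  counit := by
    refine (comodule_counit_iff (imageData G V hV).coact
      (HomAlg.counit (stdR q V.data.n)).toLinearMap).2 fun j i => ?_
    rw [matrixCoeff_imageData, AlgHom.toLinearMap_apply, counit_psi V.data hV V.isHecke,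
      counit_matrixCoeff_structMap]
  degree := by
    refine (range_le_lTensor_iff (imageData G V hV).coact _).2 fun j i => ?_
    rw [matrixCoeff_imageData]
    exact lift_mem_deg _ ((range_le_lTensor_iff V.data.coact _).1 V.isHecke.degree)
      (matrixCoeff_structMap_mem G V V j i)

/-- `exchange_relation` in A_q(W,V) for the pulled back forms. The two splittings of Δ are
coassociativity of G'' with middle object W and with middle object V. -/
theorem satisfiesRTT_structMap (V W : HeckePair.{u, v} q e) (hV : PsiWellDefined V.data)
    (hW : PsiWellDefined W.data) : SatisfiesRTT (imageData G W hW).R (imageData G V hV).R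
      (matrixCoeff (structMap G V W)) := by
  have h := exchange_relation (isRForm_pullbackR W.data W.isHecke hW)
    (isRForm_pullbackR V.data V.isHecke hV) (isMultiplicative_structMap G W)
    (isMultiplicative_structMap G V) (comul_matrixCoeff_structMap G V W W)
    (comul_matrixCoeff_structMap G V V W)
  intro p r i j
  simp only [imageData_R]
  exact h p r i j

end Composition

/-! ### Reconstruction of a functor from its structure maps. -/

section Reconstruction
variable {k : Type u} [Field k] {q : kˣ} {d e : ℕ} {X : HeckePair.{u, v} q e → FGModuleCat.{v} k}
  {θ : ∀ V W : HeckePair.{u, v} q e, X V →ₗ[k] X W ⊗[k] W.data.Alg V.data}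

theorem contract_congr {X Y : FGModuleCat.{v} k} {A : Type u} [Ring A] [Algebra k A]
    {f : X →ₗ[k] Y ⊗[k] A} {N : Submodule k A}
    (hf : LinearMap.range f ≤ LinearMap.range (N.subtype.lTensor Y)) {Φ Ψ : A →ₗ[k] k}
    (h : ∀ y ∈ N, Φ y = Ψ y) : contract Φ f = contract Ψ f := by
  apply (chosenBasis X).ext
  intro i
  rw [contract_basis, contract_basis]
  exact Finset.sum_congr rfl fun j _ => by rw [h _ ((range_le_lTensor_iff f N).1 hf j i)]

theorem contract_add {X Y : FGModuleCat.{v} k} {A : Type u} [Ring A] [Algebra k A]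
    (f : X →ₗ[k] Y ⊗[k] A) (Φ Ψ : A →ₗ[k] k) :
    contract (Φ + Ψ) f = contract Φ f + contract Ψ f := by
  simp only [contract, LinearMap.lTensor_add, LinearMap.add_comp, LinearMap.comp_add]

theorem contract_smul {X Y : FGModuleCat.{v} k} {A : Type u} [Ring A] [Algebra k A]
    (f : X →ₗ[k] Y ⊗[k] A) (c : k) (Φ : A →ₗ[k] k) :
    contract (c • Φ) f = c • contract Φ f := by
  simp only [contract, LinearMap.lTensor_smul, LinearMap.smul_comp, LinearMap.comp_smul]

/-- The converse direction of the dictionary: a coassociative family turns convolution into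
composition, which yields `map_comp` of the reconstructed functor. -/
theorem Coassociative.contract_convFunctional (h : Coassociative θ) (V W U : HeckePair.{u, v} q e)
    (Φ : U.data.Alg W.data →ₗ[k] k) (Ψ : W.data.Alg V.data →ₗ[k] k) :
    contract (convFunctional U.data W.data V.data Φ Ψ) (θ V U) =
      contract Φ (θ W U) ∘ₗ contract Ψ (θ V W) := by
  have h' : ∀ l i, HomAlg.comul U.data.R W.data.R V.data.R (matrixCoeff (θ V U) l i) = _ :=
    (comodule_coassoc_iff _ _ _ _).1 (h V W U)
  apply (chosenBasis (X V)).ext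
  intro i
  simp only [LinearMap.comp_apply, contract_basis, map_sum, map_smul, convFunctional,
    AlgHom.toLinearMap_apply, h', TensorProduct.map_tmul, LinearMap.mul'_apply,
    Finset.sum_smul, Finset.smul_sum, smul_smul]
  rw [Finset.sum_comm]
  exact Finset.sum_congr rfl fun _ _ => Finset.sum_congr rfl fun _ _ => by rw [mul_comm]

/-- A functional on `A_q(W,V)` that defines a given morphism. -/
def schurInv (d : ℕ) (V W : ComoduleData.{u, v} q) (f : ComoduleData.braidHom d V W) :
    W.Alg V →ₗ[k] k :=
  Function.surjInv (schurLin_surjective d V W) f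

theorem schurLin_schurInv (V W : ComoduleData.{u, v} q) (f : ComoduleData.braidHom d V W) :
    schurLin d V W (schurInv d V W f) = f :=
  Function.surjInv_eq _ f

/-- The functor on `Γ^d_{q,e} 𝒱` with given structure maps. -/
def functorOfStructMap
    (hdeg : ∀ V W : HeckePair.{u, v} q e, LinearMap.range (θ V W) ≤
      LinearMap.range ((HomAlg.deg W.data.R V.data.R d).subtype.lTensor (X W)))
    (hco : Coassociative θ) (hcu : Counital θ) :
    DividedPowerCat.{u, v} q d e ⥤ FGModuleCat.{v} k where
  obj V := X V.pair
  map {V W} f := FGModuleCat.ofHom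
    (contract (schurInv d V.data W.data f) (θ V.pair W.pair))
  map_id V := by
    apply FGModuleCat.hom_ext
    refine Eq.trans ?_ (hcu V.pair)
    -- The chosen functional and the counit define the same morphism, hence agree in degree d, and
    -- the contraction sees only that degree.
    refine contract_congr (hdeg _ _) fun y hy => schurLin_congr (d := d) _ _ ?_ hy
    rw [schurLin_schurInv]
    exact Subtype.ext (schurLin_counit _).symm
  map_comp {V W U} f g := by
    apply FGModuleCat.hom_ext
    refine Eq.trans ?_ (hco.contract_convFunctional V.pair W.pair U.pair
      (schurInv d W.data U.data g)
      (schurInv d V.data W.data f))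
    refine contract_congr (hdeg _ _) fun y hy => schurLin_congr (d := d) _ _ ?_ hy
    rw [schurLin_schurInv]
    apply Subtype.ext
    rw [schurLin_convFunctional, schurLin_schurInv, schurLin_schurInv]
    rfl

section
variable (hdeg : ∀ V W : HeckePair.{u, v} q e, LinearMap.range (θ V W) ≤
      LinearMap.range ((HomAlg.deg W.data.R V.data.R d).subtype.lTensor (X W)))
    (hco : Coassociative θ) (hcu : Counital θ)

theorem functorOfStructMap_map_schurLin (V W : HeckePair.{u, v} q e)
    (Φ : W.data.Alg V.data →ₗ[k] k) :
    ((functorOfStructMap hdeg hco hcu).map (X := ⟨V⟩) (Y := ⟨W⟩)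
      (schurLin d V.data W.data Φ)).hom.hom = contract Φ (θ V W) := by
  refine contract_congr (hdeg _ _) fun y hy => schurLin_congr (d := d) _ _ ?_ hy
  rw [schurLin_schurInv]

instance : (functorOfStructMap hdeg hco hcu).Additive where
  map_add {V W f g} := by
    -- Once f and g are given by functionals, additivity reduces to linearity of the contraction in
    -- the functional.
    obtain ⟨Φ, rfl⟩ := schurLin_surjective d V.data W.data f
    obtain ⟨Ψ, rfl⟩ := schurLin_surjective d V.data W.data g
    apply FGModuleCat.hom_ext
    have h := functorOfStructMap_map_schurLin hdeg hco hcu V.pair W.pair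
    have h' := h (Φ + Ψ)
    rw [map_add, contract_add, ← h Φ, ← h Ψ] at h'
    exact h'

instance : (functorOfStructMap hdeg hco hcu).Linear k where
  map_smul {V W} f c := by
    obtain ⟨Φ, rfl⟩ := schurLin_surjective d V.data W.data f
    apply FGModuleCat.hom_ext
    have h := functorOfStructMap_map_schurLin hdeg hco hcu V.pair W.pair
    have h' := h (c • Φ)
    rw [map_smul, contract_smul, ← h Φ] at h'
    exact h'

theorem structMap_functorOfStructMap (V W : HeckePair.{u, v} q e) :
    structMap (functorOfStructMap hdeg hco hcu) V W = θ V W := by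
  apply ext_contract
  intro Φ
  rw [contract_structMap]
  exact functorOfStructMap_map_schurLin hdeg hco hcu V W Φ

end

theorem contract_rTensor_comp {X Y Z : FGModuleCat.{v} k} {A : Type u} [Ring A] [Algebra k A]
    (Φ : A →ₗ[k] k) (f : X →ₗ[k] Y ⊗[k] A) (g : Y →ₗ[k] Z) :
    contract Φ (g.rTensor A ∘ₗ f) = g ∘ₗ contract Φ f := by
  have : (TensorProduct.rid k Z).toLinearMap ∘ₗ Φ.lTensor Z ∘ₗ g.rTensor A =
      g ∘ₗ (TensorProduct.rid k Y).toLinearMap ∘ₗ Φ.lTensor Y := by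
    apply TensorProduct.ext'
    intro y a
    simp
  exact congrArg (· ∘ₗ f) this

/-- A functor is determined by its structure maps: the action on morphisms. -/
theorem map_schurLin_comp_eqToHom (H : DividedPowerCat.{u, v} q d e ⥤ FGModuleCat.{v} k)
    [H.Additive] [H.Linear k] (hH : ∀ V : HeckePair.{u, v} q e, H.obj ⟨V⟩ = X V)
    (h : ∀ V W : HeckePair.{u, v} q e,
      (eqToHom (hH W)).hom.hom.rTensor (W.data.Alg V.data) ∘ₗ structMap H V W =
        θ V W ∘ₗ (eqToHom (hH V)).hom.hom) (V W : HeckePair.{u, v} q e)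
    (Φ : W.data.Alg V.data →ₗ[k] k) :
    H.map (X := ⟨V⟩) (Y := ⟨W⟩) (schurLin d V.data W.data Φ) ≫ eqToHom (hH W) =
      eqToHom (hH V) ≫ FGModuleCat.ofHom (contract Φ (θ V W)) := by
  apply FGModuleCat.hom_ext
  have e := contract_rTensor_comp Φ (structMap H V W) (eqToHom (hH W)).hom.hom
  rw [h, contract_structMap, functorAction_apply] at e
  exact e.symm

/-- Uniqueness: contracting the structure map recovers the action on every morphism of the form
`schurLin d V W Φ`, and all morphisms have this form. The competing functor agrees on objects only
up to a propositional equality, whence the transports by `eqToHom`. -/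
theorem existsUnique_functor
    (hdeg : ∀ V W : HeckePair.{u, v} q e, LinearMap.range (θ V W) ≤
      LinearMap.range ((HomAlg.deg W.data.R V.data.R d).subtype.lTensor (X W)))
    (hco : Coassociative θ) (hcu : Counital θ) :
    ∃! H : DividedPowerCat.{u, v} q d e ⥤ FGModuleCat.{v} k,
      H.Additive ∧ H.Linear k ∧ ∃ hH : ∀ V : HeckePair.{u, v} q e, H.obj ⟨V⟩ = X V,
        ∀ V W : HeckePair.{u, v} q e,
          (eqToHom (hH W)).hom.hom.rTensor (W.data.Alg V.data) ∘ₗ structMap H V W =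
            θ V W ∘ₗ (eqToHom (hH V)).hom.hom := by
  refine ⟨functorOfStructMap hdeg hco hcu, ⟨inferInstance, inferInstance, fun V => rfl,
    fun V W => ?_⟩, ?_⟩
  · rw [structMap_functorOfStructMap]
    change LinearMap.id.rTensor _ ∘ₗ θ V W = θ V W ∘ₗ LinearMap.id
    rw [LinearMap.rTensor_id, LinearMap.id_comp, LinearMap.comp_id]
  · rintro H ⟨_, _, hH, h⟩
    refine CategoryTheory.Functor.ext (fun V : DividedPowerCat q d e => hH V.pair) fun V W f => ?_
    obtain ⟨Φ, rfl⟩ := schurLin_surjective d V.data W.data f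
    have h1 := map_schurLin_comp_eqToHom H hH h V.pair W.pair Φ
    have h2 : (functorOfStructMap hdeg hco hcu).map (X := V) (Y := W)
        (schurLin d V.data W.data Φ) = FGModuleCat.ofHom (contract Φ (θ V.pair W.pair)) :=
      FGModuleCat.hom_ext (functorOfStructMap_map_schurLin hdeg hco hcu V.pair W.pair Φ)
    rw [h2]
    exact ((comp_eqToHom_iff _ _ _).1 h1).trans (Category.assoc _ _ _)

end Reconstruction
end

end QPoly

/-! ### The composition theorem. -/

open QPoly
theorem theorem5p2 {k : Type u} [Field k] (q : kˣ) (d₁ d₂ e : ℕ)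
    (G : DividedPowerCat.{u, v} q d₂ e ⥤ FGModuleCat.{v} k) [G.Additive] [G.Linear k]
    (F : DividedPowerCat.{u, v} q d₁ (d₂ * e) ⥤ FGModuleCat.{v} k) [F.Additive] [F.Linear k] :
    ∃ (hψ : ∀ V : HeckePair.{u, v} q e, PsiWellDefined V.data)
      (hG : ∀ V : HeckePair.{u, v} q e, (imageData G V (hψ V)).IsHecke (d₂ * e))
      (hψG : ∀ V W : HeckePair.{u, v} q e, SatisfiesRTT (imageData G W (hψ W)).R
        (imageData G V (hψ V)).R (matrixCoeff (structMap G V W))),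
      let GV : HeckePair.{u, v} q e → HeckePair.{u, v} q (d₂ * e) :=
        fun V => ⟨imageData G V (hψ V), hG V⟩
      let FG : HeckePair.{u, v} q e → FGModuleCat.{v} k := fun V => F.obj ⟨GV V⟩
      let ψG : ∀ W V : HeckePair.{u, v} q e,
          (GV W).data.Alg (GV V).data →ₐ[k] W.data.Alg V.data :=
        fun W V => HomAlg.lift _ _ (matrixCoeff (structMap G V W)) (hψG V W)
      let FG'' : ∀ V W : HeckePair.{u, v} q e, FG V →ₗ[k] FG W ⊗[k] W.data.Alg V.data :=
        fun V W => (ψG W V).toLinearMap.lTensor (FG W) ∘ₗ structMap F (GV V) (GV W)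
      (∀ V W : HeckePair.{u, v} q e, LinearMap.range (FG'' V W) ≤
        LinearMap.range ((HomAlg.deg W.data.R V.data.R (d₁ * d₂)).subtype.lTensor (FG W))) ∧
      Coassociative FG'' ∧
      Counital FG'' ∧
      ∃! H : DividedPowerCat.{u, v} q (d₁ * d₂) e ⥤ FGModuleCat.{v} k,
        H.Additive ∧ H.Linear k ∧
        ∃ hH : ∀ V : HeckePair.{u, v} q e, H.obj ⟨V⟩ = FG V,
          ∀ V W : HeckePair.{u, v} q e,
            (eqToHom (hH W)).hom.hom.rTensor (W.data.Alg V.data) ∘ₗ structMap H V W =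
              FG'' V W ∘ₗ (eqToHom (hH V)).hom.hom := by
  have hψ : ∀ V : HeckePair.{u, v} q e, PsiWellDefined V.data :=
    fun V => psiWellDefined V.data V.isHecke
  have hG : ∀ V : HeckePair.{u, v} q e, (imageData G V (hψ V)).IsHecke (d₂ * e) :=
    fun V => imageData_isHecke G V (hψ V)
  have hψG : ∀ V W : HeckePair.{u, v} q e, SatisfiesRTT (imageData G W (hψ W)).R
      (imageData G V (hψ V)).R (matrixCoeff (structMap G V W)) :=
    fun V W => satisfiesRTT_structMap G V W (hψ V) (hψ W)
  refine ⟨hψ, hG, hψG, ?_⟩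
  intro GV FG ψG FG''
  have hcoeff : ∀ V W, matrixCoeff (FG'' V W) =
      fun j i => ψG W V (matrixCoeff (structMap F (GV V) (GV W)) j i) :=
    fun V W => matrixCoeff_lTensor (ψG W V).toLinearMap (structMap F (GV V) (GV W))
  have hψG_gen : ∀ V W (j : (GV W).data.Idx) (i : (GV V).data.Idx),
      ψG W V (HomAlg.gen _ _ j i) = matrixCoeff (structMap G V W) j i :=
    fun V W j i => HomAlg.lift_gen _ _ _ (hψG V W) j i
  have hdeg : ∀ V W : HeckePair.{u, v} q e, LinearMap.range (FG'' V W) ≤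
      LinearMap.range ((HomAlg.deg W.data.R V.data.R (d₁ * d₂)).subtype.lTensor (FG W)) := by
    intro V W
    refine (range_le_lTensor_iff _ _).2 fun j i => ?_
    rw [hcoeff]
    -- ψ^G sends generators to degree d₂, and the coefficients of F'' have degree d₁.
    exact lift_mem_deg (hψG V W) (matrixCoeff_structMap_mem G V W)
      (matrixCoeff_structMap_mem F (GV V) (GV W) j i)
  have hco : Coassociative FG'' := by
    intro V W U
    refine (comodule_coassoc_iff _ _ _ _).2 fun l i => ?_
    -- The maps ψ^G commute with Δ: on generators this is coassociativity of G''. Coassociativity of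
    -- F'' can then be transported along them.
    have hΔ : (HomAlg.comul U.data.R W.data.R V.data.R).comp (ψG U V) =
        (Algebra.TensorProduct.map (ψG U W) (ψG W V)).comp
          (HomAlg.comul (GV U).data.R (GV W).data.R (GV V).data.R) := by
      apply HomAlg.algHom_ext
      intro j i
      simp only [AlgHom.comp_apply, hψG_gen, HomAlg.comul_gen, map_sum,
        Algebra.TensorProduct.map_tmul]
      exact comul_matrixCoeff_structMap G V W U j i
    simp only [hcoeff]
    refine (DFunLike.congr_fun hΔ _).trans ?_
    rw [AlgHom.comp_apply, comul_matrixCoeff_structMap F (GV V) (GV W) (GV U), map_sum]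
    rfl
  have hcu : Counital FG'' := by
    intro V
    refine (comodule_counit_iff _ _).2 fun j i => ?_
    -- Likewise for ε, where the generator case is the counit property of G''.
    have hε : (HomAlg.counit V.data.R).comp (ψG V V) = HomAlg.counit (GV V).data.R := by
      apply HomAlg.algHom_ext
      intro j i
      simp only [AlgHom.comp_apply, hψG_gen, HomAlg.counit_gen]
      exact counit_matrixCoeff_structMap G V j i
    rw [hcoeff]
    refine (DFunLike.congr_fun hε _).trans ?_
    exact counit_matrixCoeff_structMap F (GV V) j i
  exact ⟨hdeg, hco, hcu, existsUnique_functor hdeg hco hcu⟩
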